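/- Let $n\ge 0$ be an integer, and work with algebraic varieties over $\mathbb C$, $G=\mathbf{GL}(n)$, and $T=(\mathbb C^*)^n\subset G$ the torus of diagonal matrices. Let $q_1,\dots,q_n$ be the coordinate projectors of $\mathbb C^n$. Let $X$ be the variety of complete systems $(p_1,\dots,p_n)$ of $n\times n$ projectors of rank $1$ with $p_ip_j=0$ for $i\ne j$ (so that $X=G/T$ via $p_i=gq_ig^{-1}$), and let $Y$ be the variety of all $n$-tuples $(r_1,\dots,r_n)$ of $n\times n$ projectors of rank $1$, that is, the product of $n$ copies of the coadjoint orbit of projectors of rank $1$, with the symplectic form $\omega_Y=\mathrm{Tr}\sum_i r_i\,dr_i\wedge dr_i$. Consider $\Omega^1G=G\times \mathrm{Mat}_{n\times n}$ with coordinates $(g,A)$, the form $\mathrm{Tr}\,dA\wedge dg$, the $T$-action $t\cdot(g,A)=(gt^{-1},tA)$ and its moment map $\mu_T(g,A)=\mathrm{diag}(Ag)$. Here, for matrix-valued functions $F,H$, the form $\mathrm{Tr}\,dF\wedge dH$ takes the value $\mathrm{Tr}(dF(u)\,dH(v))-\mathrm{Tr}(dF(v)\,dH(u))$ on tangent vectors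 $u,v$, and $\omega_Y(u,v)=\sum_i\mathrm{Tr}\,r_i\bigl(dr_i(u)\,dr_i(v)-dr_i(v)\,dr_i(u)\bigr)$. Let $\mu_T^{-1}(0)/T$ be the symplectic reduction, with its quotient structure, and let $\Omega^1X$ be the total space of the cotangent bundle of $X$. **Theorem.** There is an isomorphism of varieties $\mu_T^{-1}(0)/T\cong\Omega^1X$ that sends the class of $(g,A)$ to the covector $\xi$ at $p=(gq_ig^{-1})_i$ whose pull-back along $\mu_T^{-1}(0)\to X$, $(g,A)\mapsto(gq_ig^{-1})_i$, is $\mathrm{Tr}(A\,dg)$. Under this identification, the ($T$-invariant) formula $$r_i=gq_ig^{-1}(1+gA),\qquad i=1,\dots,n,$$ for $(g,A)\in\mu_T^{-1}(0)$, defines a morphism $\phi:\Omega^1X\to Y$, which is an open embedding of varieties: it is an isomorphism onto a Zariski open subvariety of $Y$. Moreover, $\phi$ is symplectic: $\phi^*\omega_Y$ is the unique form on $\Omega^1X$ whose pull-back to $\mu_T^{-1}(0)$ is the restriction of $\mathrm{Tr}\,dA\wedge dg$, and it is equal to the canonical form $d\theta$ of the cotangent bundle, where $\theta$ is the tautological $1$-form.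 The latter is characterized as the unique form on $\Omega^1X$ whose pull-back along $((p_i),(C_i))\mapsto\sum_i\mathrm{Tr}(C_i\,dp_i)\in\Omega^1_pX$, where $(p_i)\in X$ and $C_i\in\mathrm{Mat}_{n\times n}$, is $\sum_i\mathrm{Tr}\,dC_i\wedge dp_i$. -/

import Mathlib

/-!
# Complex varieties as spaces with functions, and the map from the cotangent bundle of the variety
of complete systems of orthogonal rank one projectors to the product of coadjoint orbits
-/

open scoped Topology

/-! ## Spaces with functions -/

/-- A space with functions over `ℂ`: a topological space with a sheaf of `ℂ`-valued functions.
The sheaf is given through its germs: `RegAt f x` says that `f` is regular near `x`; a function is a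
section over an open set `W` when it is regular at all points of `W` (values outside `W` are
irrelevant by `regAt_congr`). Complex algebraic varieties are such spaces. -/
structure SpaceWithFunctions where
  carrier : Type
  top : TopologicalSpace carrier
  RegAt : (carrier → ℂ) → carrier → Prop
  regAt_congr : ∀ {f g : carrier → ℂ} {x : carrier} {W : Set carrier}, IsOpen[top] W → x ∈ W →
    (∀ y ∈ W, f y = g y) → RegAt f x → RegAt g x
  regAt_nhds : ∀ {f : carrier → ℂ} {x : carrier}, RegAt f x →
    ∃ W : Set carrier, IsOpen[top] W ∧ x ∈ W ∧ ∀ y ∈ W, RegAt f y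
  regAt_const : ∀ (c : ℂ) (x : carrier), RegAt (fun _ => c) x
  regAt_add : ∀ {f g : carrier → ℂ} {x : carrier}, RegAt f x → RegAt g x →
    RegAt (fun y => f y + g y) x
  regAt_mul : ∀ {f g : carrier → ℂ} {x : carrier}, RegAt f x → RegAt g x →
    RegAt (fun y => f y * g y) x
  regAt_ne : ∀ {f : carrier → ℂ} {x : carrier}, RegAt f x → f x ≠ 0 →
    ∃ W : Set carrier, IsOpen[top] W ∧ x ∈ W ∧ ∀ y ∈ W, f y ≠ 0
  regAt_inv : ∀ {f : carrier → ℂ} {x : carrier}, RegAt f x → f x ≠ 0 →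
    RegAt (fun y => (f y)⁻¹) x

namespace SpaceWithFunctions

instance : CoeSort SpaceWithFunctions Type := ⟨carrier⟩

/-- The algebra of functions that are regular at `x`. -/
def regularAt (M : SpaceWithFunctions) (x : M) : Subalgebra ℂ (M → ℂ) where
  carrier := {f | M.RegAt f x}
  mul_mem' := fun hf hg => M.regAt_mul hf hg
  add_mem' := fun hf hg => M.regAt_add hf hg
  algebraMap_mem' := fun c => M.regAt_const c x

/-- The (Zariski) tangent space at `x`: point derivations of the functions regular at `x`.
By the Leibniz rule, such a derivation depends only on germs at `x`. -/
def tangentSpace (M : SpaceWithFunctions) (x : M) : Submodule ℂ (M.regularAt x →ₗ[ℂ] ℂ) where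
  carrier := {D | ∀ f g : M.regularAt x,
    D (f * g) = (f : M → ℂ) x * D g + (g : M → ℂ) x * D f}
  zero_mem' := by intro f g; simp
  add_mem' := by
    intro D E hD hE f g
    simp only [LinearMap.add_apply]
    rw [hD f g, hE f g]; ring
  smul_mem' := by
    intro c D hD f g
    simp only [LinearMap.smul_apply, smul_eq_mul]
    rw [hD f g]; ring

/-- A morphism of spaces with functions: a continuous map that pulls regular functions back to
regular functions. -/
structure RegularMap (M N : SpaceWithFunctions) where
  toFun : M → N
  isOpen_preimage : ∀ W : Set N, IsOpen[N.top] W → IsOpen[M.top] (toFun ⁻¹' W)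
  regAt_comp : ∀ {f : N → ℂ} {x : M}, N.RegAt f (toFun x) → M.RegAt (fun y => f (toFun y)) x

namespace RegularMap

variable {M N P : SpaceWithFunctions}

instance : CoeFun (RegularMap M N) (fun _ => M → N) := ⟨toFun⟩

/-- Composition of morphisms. -/
def comp (ψ : RegularMap N P) (φ : RegularMap M N) : RegularMap M P where
  toFun := fun x => ψ (φ x)
  isOpen_preimage := fun W hW => φ.isOpen_preimage _ (ψ.isOpen_preimage W hW)
  regAt_comp := fun h => φ.regAt_comp (ψ.regAt_comp h)

/-- The differential of a morphism, `(dφ D)(f) = D (f ∘ φ)`. -/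
def tangentMap (φ : RegularMap M N) (x : M) : M.tangentSpace x →ₗ[ℂ] N.tangentSpace (φ x) where
  toFun D := ⟨{ toFun := fun f => D.1 ⟨fun y => (f : N → ℂ) (φ y), φ.regAt_comp f.2⟩
                map_add' := fun f g => D.1.map_add
                  ⟨fun y => (f : N → ℂ) (φ y), φ.regAt_comp f.2⟩
                  ⟨fun y => (g : N → ℂ) (φ y), φ.regAt_comp g.2⟩
                map_smul' := fun c f => D.1.map_smul c
                  ⟨fun y => (f : N → ℂ) (φ y), φ.regAt_comp f.2⟩ },
              fun f g => D.2
                ⟨fun y => (f : N → ℂ) (φ y), φ.regAt_comp f.2⟩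
                ⟨fun y => (g : N → ℂ) (φ y), φ.regAt_comp g.2⟩⟩
  map_add' := fun _ _ => rfl
  map_smul' := fun _ _ => rfl

/-- An open embedding (open immersion): a homeomorphism onto an open subset of the target which
identifies the regular functions on the source with those on this open subset. -/
def IsOpenEmbedding (φ : RegularMap M N) : Prop :=
  @Topology.IsOpenEmbedding M N M.top N.top φ ∧
    ∀ (f : N → ℂ) (x : M), M.RegAt (fun y => f (φ y)) x → N.RegAt f (φ x)

end RegularMap

/-- An isomorphism of spaces with functions. -/
structure RegularEquiv (M N : SpaceWithFunctions) where
  toMap : RegularMap M N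
  invMap : RegularMap N M
  left_inv : ∀ x, invMap (toMap x) = x
  right_inv : ∀ y, toMap (invMap y) = y

/-- A family of bilinear forms on the tangent spaces. -/
def TwoTensor (M : SpaceWithFunctions) : Type :=
  ∀ x : M, LinearMap.BilinForm ℂ (M.tangentSpace x)

/-- Pull-back `φ^* ω`. -/
def TwoTensor.pullback {M N : SpaceWithFunctions} (φ : RegularMap M N) (ω : TwoTensor N) :
    TwoTensor M :=
  fun x => (ω (φ x)).compl₁₂ (φ.tangentMap x) (φ.tangentMap x)

/-- Matrix-valued regular functions. -/
def MatrixFunction (M : SpaceWithFunctions) (n : ℕ) : Type :=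
  {F : M → Matrix (Fin n) (Fin n) ℂ // ∀ (x : M) (a b : Fin n), M.RegAt (fun y => F y a b) x}

/-- The differential `dF` of a matrix-valued function `F`, a matrix-valued 1-form. -/
def MatrixFunction.d {M : SpaceWithFunctions} {n : ℕ} (F : M.MatrixFunction n) (x : M) :
    M.tangentSpace x →ₗ[ℂ] Matrix (Fin n) (Fin n) ℂ where
  toFun D := Matrix.of fun a b => D.1 ⟨fun y => F.1 y a b, F.2 x a b⟩
  map_add' := fun _ _ => rfl
  map_smul' := fun _ _ => rfl

theorem isOpen_inter (M : SpaceWithFunctions) {U W : Set M} (hU : IsOpen[M.top] U)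
    (hW : IsOpen[M.top] W) : IsOpen[M.top] (U ∩ W) :=
  letI := M.top
  IsOpen.inter hU hW

/-- The quotient structure along `π : M → Q`: a set is open, resp. a function is regular, when its
pull-back to `M` is. -/
def coinduced (M : SpaceWithFunctions) {Q : Type} (π : M → Q) : SpaceWithFunctions where
  carrier := Q
  top := @TopologicalSpace.coinduced M Q π M.top
  RegAt f y := ∃ W : Set Q, IsOpen[M.top] (π ⁻¹' W) ∧ y ∈ W ∧
    ∀ x : M, π x ∈ W → M.RegAt (fun z => f (π z)) x
  regAt_congr := by
    rintro f g y W hW hy hfg ⟨W', hW', hy', h⟩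
    have hW0 : IsOpen[M.top] (π ⁻¹' W) := hW
    refine ⟨W ∩ W', M.isOpen_inter hW0 hW', ⟨hy, hy'⟩, fun x hx => ?_⟩
    exact M.regAt_congr (W := π ⁻¹' W) hW0 hx.1 (fun z hz => hfg _ hz) (h x hx.2)
  regAt_nhds := by
    rintro f y ⟨W, hW, hy, h⟩
    exact ⟨W, hW, hy, fun y' hy' => ⟨W, hW, hy', h⟩⟩
  regAt_const := fun c y => ⟨Set.univ, @isOpen_univ _ M.top, trivial,
    fun x _ => M.regAt_const c x⟩
  regAt_add := by
    rintro f g y ⟨W, hW, hy, h⟩ ⟨W', hW', hy', h'⟩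
    exact ⟨W ∩ W', M.isOpen_inter hW hW', ⟨hy, hy'⟩,
      fun x hx => M.regAt_add (h x hx.1) (h' x hx.2)⟩
  regAt_mul := by
    rintro f g y ⟨W, hW, hy, h⟩ ⟨W', hW', hy', h'⟩
    exact ⟨W ∩ W', M.isOpen_inter hW hW', ⟨hy, hy'⟩,
      fun x hx => M.regAt_mul (h x hx.1) (h' x hx.2)⟩
  regAt_ne := by
    rintro f y ⟨W, hW, hy, h⟩ hf
    refine ⟨W ∩ {y | f y ≠ 0}, ?_, ⟨hy, hf⟩, fun y hy => hy.2⟩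
    change IsOpen[M.top] (π ⁻¹' (W ∩ {y | f y ≠ 0}))
    rw [@isOpen_iff_forall_mem_open _ M.top]
    intro x hx
    obtain ⟨V, hV, hxV, hne⟩ := M.regAt_ne (h x hx.1) hx.2
    exact ⟨(π ⁻¹' W) ∩ V, fun z hz => ⟨hz.1, hne z hz.2⟩,
      M.isOpen_inter hW hV, ⟨hx.1, hxV⟩⟩
  regAt_inv := by
    rintro f y ⟨W, hW, hy, h⟩ hf
    refine ⟨W ∩ {y | f y ≠ 0}, ?_, ⟨hy, hf⟩, fun x hx => M.regAt_inv (h x hx.1) hx.2⟩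
    rw [@isOpen_iff_forall_mem_open _ M.top]
    intro x hx
    obtain ⟨V, hV, hxV, hne⟩ := M.regAt_ne (h x hx.1) hx.2
    exact ⟨(π ⁻¹' W) ∩ V, fun z hz => ⟨hz.1, hne z hz.2⟩,
      M.isOpen_inter hW hV, ⟨hx.1, hxV⟩⟩

/-- The quotient map as a morphism. -/
def toCoinduced (M : SpaceWithFunctions) {Q : Type} (π : M → Q) :
    RegularMap M (M.coinduced π) where
  toFun := π
  isOpen_preimage := fun _ hW => hW
  regAt_comp := by
    rintro f x ⟨W, _, hx, h⟩
    exact h x hx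

/-- A morphism `φ : M → N` that factors through `π` as a map of sets induces a morphism from the
quotient. -/
def descend {M N : SpaceWithFunctions} {Q : Type} (π : M → Q) (φ : RegularMap M N) (ψ : Q → N)
    (h : ∀ x, ψ (π x) = φ x) : RegularMap (M.coinduced π) N where
  toFun := ψ
  isOpen_preimage := by
    intro W hW
    change IsOpen[M.top] (π ⁻¹' (ψ ⁻¹' W))
    have : π ⁻¹' (ψ ⁻¹' W) = φ ⁻¹' W := by ext x; simp [h]
    rw [this]; exact φ.isOpen_preimage W hW
  regAt_comp := by
    intro f y hf
    obtain ⟨W, hW, hy, hreg⟩ := N.regAt_nhds hf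
    refine ⟨ψ ⁻¹' W, ?_, hy, fun x hx => ?_⟩
    · have : π ⁻¹' (ψ ⁻¹' W) = φ ⁻¹' W := by ext x; simp [h]
      rw [this]; exact φ.isOpen_preimage W hW
    · have hx' : φ x ∈ W := by rw [← h x]; exact hx
      have := φ.regAt_comp (hreg _ hx')
      simpa only [h] using this

/-! ## Subvarieties of affine spaces -/

section Affine

variable {V : Type} [AddCommGroup V] [Module ℂ V]

/-- Polynomial functions on a vector space. -/
def polynomialFunctions (V : Type) [AddCommGroup V] [Module ℂ V] : Subalgebra ℂ (V → ℂ) :=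
  Algebra.adjoin ℂ {f | ∃ l : V →ₗ[ℂ] ℂ, f = l}

/-- The Zariski topology on a subset `S` of a vector space, generated by the sets `{P ≠ 0}`. -/
@[reducible] def zariski (S : Set V) : TopologicalSpace S :=
  TopologicalSpace.generateFrom
    {W | ∃ P ∈ polynomialFunctions V, W = {z : S | P z ≠ 0}}

theorem isOpen_zariski_basic {S : Set V} {P : V → ℂ} (hP : P ∈ polynomialFunctions V) :
    IsOpen[zariski S] {z : S | P z ≠ 0} :=
  TopologicalSpace.isOpen_generateFrom_of_mem ⟨P, hP, rfl⟩

theorem exists_basic_of_isOpen_zariski {S : Set V} {W : Set S} (hW : IsOpen[zariski S] W)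
    {x : S} (hx : x ∈ W) :
    ∃ P ∈ polynomialFunctions V, P x ≠ 0 ∧ ∀ y : S, P y ≠ 0 → y ∈ W := by
  induction hW with
  | basic U hU =>
    obtain ⟨P, hP, rfl⟩ := hU
    exact ⟨P, hP, hx, fun y hy => hy⟩
  | univ => exact ⟨1, one_mem _, by simp, fun y _ => trivial⟩
  | inter U U' _ _ ih ih' =>
    obtain ⟨P, hP, hPx, h⟩ := ih hx.1
    obtain ⟨P', hP', hPx', h'⟩ := ih' hx.2
    exact ⟨P * P', mul_mem hP hP', mul_ne_zero hPx hPx', fun y hy =>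
      ⟨h y (left_ne_zero_of_mul hy), h' y (right_ne_zero_of_mul hy)⟩⟩
  | sUnion 𝒰 _ ih =>
    obtain ⟨U, hU, hxU⟩ := hx
    obtain ⟨P, hP, hPx, h⟩ := ih U hU hxU
    exact ⟨P, hP, hPx, fun y hy => ⟨U, hU, h y hy⟩⟩

/-- A (locally closed) subset `S` of a vector space as a variety, with the Zariski topology; a
function is regular at `x` when it is a quotient of polynomials in a neighbourhood of `x`. -/
def affine (S : Set V) : SpaceWithFunctions where
  carrier := S
  top := zariski S
  RegAt f x := ∃ P ∈ polynomialFunctions V, ∃ Q ∈ polynomialFunctions V,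
    Q x ≠ 0 ∧ ∀ y : S, Q y ≠ 0 → f y = P y / Q y
  regAt_congr := by
    rintro f g x W hW hx hfg ⟨P, hP, Q, hQ, hQx, h⟩
    obtain ⟨R, hR, hRx, hRW⟩ := exists_basic_of_isOpen_zariski hW hx
    refine ⟨P * R, mul_mem hP hR, Q * R, mul_mem hQ hR, mul_ne_zero hQx hRx, fun y hy => ?_⟩
    have h1 : Q y ≠ 0 := left_ne_zero_of_mul hy
    have h2 : R y ≠ 0 := right_ne_zero_of_mul hy
    rw [← hfg y (hRW y h2), h y h1]
    exact (mul_div_mul_right _ _ h2).symm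
  regAt_nhds := by
    rintro f x ⟨P, hP, Q, hQ, hQx, h⟩
    exact ⟨_, isOpen_zariski_basic hQ, hQx, fun y hy => ⟨P, hP, Q, hQ, hy, h⟩⟩
  regAt_const := fun c x => ⟨algebraMap ℂ _ c, Subalgebra.algebraMap_mem _ c, 1, one_mem _,
    by simp, fun y _ => by simp⟩
  regAt_add := by
    rintro f g x ⟨P, hP, Q, hQ, hQx, h⟩ ⟨P', hP', Q', hQ', hQx', h'⟩
    refine ⟨P * Q' + Q * P', add_mem (mul_mem hP hQ') (mul_mem hQ hP'), Q * Q', mul_mem hQ hQ',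
      mul_ne_zero hQx hQx', fun y hy => ?_⟩
    have h1 : Q y ≠ 0 := left_ne_zero_of_mul hy
    have h2 : Q' y ≠ 0 := right_ne_zero_of_mul hy
    beta_reduce
    rw [h y h1, h' y h2]
    exact div_add_div _ _ h1 h2
  regAt_mul := by
    rintro f g x ⟨P, hP, Q, hQ, hQx, h⟩ ⟨P', hP', Q', hQ', hQx', h'⟩
    refine ⟨P * P', mul_mem hP hP', Q * Q', mul_mem hQ hQ', mul_ne_zero hQx hQx', fun y hy => ?_⟩
    beta_reduce
    rw [h y (left_ne_zero_of_mul hy), h' y (right_ne_zero_of_mul hy)]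
    exact div_mul_div_comm _ _ _ _
  regAt_ne := by
    rintro f x ⟨P, hP, Q, hQ, hQx, h⟩ hf
    have hPx : P x ≠ 0 := by
      intro h0; apply hf; rw [h x hQx, h0, zero_div]
    refine ⟨_, isOpen_zariski_basic (mul_mem hP hQ), mul_ne_zero hPx hQx, fun y hy => ?_⟩
    rw [h y (right_ne_zero_of_mul hy)]
    exact div_ne_zero (left_ne_zero_of_mul hy) (right_ne_zero_of_mul hy)
  regAt_inv := by
    rintro f x ⟨P, hP, Q, hQ, hQx, h⟩ hf
    have hPx : P x ≠ 0 := by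
      intro h0; apply hf; rw [h x hQx, h0, zero_div]
    refine ⟨Q * Q, mul_mem hQ hQ, P * Q, mul_mem hP hQ, mul_ne_zero hPx hQx, fun y hy => ?_⟩
    have h2 : Q y ≠ 0 := right_ne_zero_of_mul hy
    beta_reduce
    rw [h y h2, inv_div]
    exact (mul_div_mul_right _ _ h2).symm

theorem regAt_affine_of_mem {S : Set V} {P : V → ℂ} (hP : P ∈ polynomialFunctions V) (x : S) :
    (affine S).RegAt (fun y : S => P y) x :=
  ⟨P, hP, 1, one_mem _, by simp, fun y _ => by simp⟩

theorem regAt_affine_linear {S : Set V} (l : V →ₗ[ℂ] ℂ) (x : S) :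
    (affine S).RegAt (fun y : S => l y) x :=
  regAt_affine_of_mem (Algebra.subset_adjoin ⟨l, rfl⟩) x

/-- A map to a subvariety of a vector space with regular coordinates is a morphism. -/
def RegularMap.mkAffine {M : SpaceWithFunctions} {S : Set V} (F : M → S)
    (hF : ∀ (l : V →ₗ[ℂ] ℂ) (x : M), M.RegAt (fun y => l (F y)) x) :
    RegularMap M (affine S) :=
  have key : ∀ P ∈ polynomialFunctions V, ∀ x : M, M.RegAt (fun y => P (F y)) x := by
    intro P hP
    induction hP using Algebra.adjoin_induction with
    | mem P hP => obtain ⟨l, rfl⟩ := hP; exact hF l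
    | algebraMap c => exact fun x => M.regAt_const c x
    | add P Q _ _ h h' => exact fun x => M.regAt_add (h x) (h' x)
    | mul P Q _ _ h h' => exact fun x => M.regAt_mul (h x) (h' x)
  have cont : ∀ W : Set S, IsOpen[zariski S] W → IsOpen[M.top] (F ⁻¹' W) := by
    intro W hW
    rw [@isOpen_iff_forall_mem_open _ M.top]
    intro x hx
    obtain ⟨P, hP, hPx, h⟩ := exists_basic_of_isOpen_zariski hW hx
    obtain ⟨U, hU, hxU, hne⟩ := M.regAt_ne (key P hP x) hPx
    exact ⟨U, fun y hy => h _ (hne y hy), hU, hxU⟩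
  { toFun := F
    isOpen_preimage := cont
    regAt_comp := by
      rintro f x ⟨P, hP, Q, hQ, hQx, h⟩
      have hreg : M.RegAt (fun y => P (F y) * (Q (F y))⁻¹) x :=
        M.regAt_mul (key P hP x) (M.regAt_inv (key Q hQ x) hQx)
      refine M.regAt_congr (cont _ (isOpen_zariski_basic hQ)) hQx (fun y hy => ?_) hreg
      rw [h _ hy, div_eq_mul_inv] }

end Affine

/-! ### Regularity of matrix expressions -/

namespace MatrixFunction

variable {M : SpaceWithFunctions} {n : ℕ}

theorem regAt_sum {ι : Type} (s : Finset ι) (f : ι → M → ℂ) (x : M)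
    (h : ∀ i ∈ s, M.RegAt (f i) x) : M.RegAt (fun y => ∑ i ∈ s, f i y) x := by
  have : (∑ i ∈ s, f i) ∈ M.regularAt x := Subalgebra.sum_mem _ h
  have h2 : M.RegAt (∑ i ∈ s, f i) x := this
  convert h2 using 1
  ext y; simp

theorem regAt_prod {ι : Type} (s : Finset ι) (f : ι → M → ℂ) (x : M)
    (h : ∀ i ∈ s, M.RegAt (f i) x) : M.RegAt (fun y => ∏ i ∈ s, f i y) x := by
  have : (∏ i ∈ s, f i) ∈ M.regularAt x := Subalgebra.prod_mem _ h
  have h2 : M.RegAt (∏ i ∈ s, f i) x := this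
  convert h2 using 1
  ext y; simp

/-- A constant matrix. -/
def const (M : SpaceWithFunctions) (C : Matrix (Fin n) (Fin n) ℂ) : M.MatrixFunction n :=
  ⟨fun _ => C, fun x _ _ => M.regAt_const _ x⟩

/-- Sum of matrix-valued functions. -/
def add (F H : M.MatrixFunction n) : M.MatrixFunction n :=
  ⟨fun y => F.1 y + H.1 y, fun x a b => M.regAt_add (F.2 x a b) (H.2 x a b)⟩

/-- Product of matrix-valued functions. -/
def mul (F H : M.MatrixFunction n) : M.MatrixFunction n :=
  ⟨fun y => F.1 y * H.1 y, fun x a b => by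
    simp only [Matrix.mul_apply]
    exact regAt_sum _ (fun c y => F.1 y a c * H.1 y c b) x
      fun c _ => M.regAt_mul (F.2 x a c) (H.2 x c b)⟩

theorem regAt_det (F : M.MatrixFunction n) (x : M) : M.RegAt (fun y => (F.1 y).det) x := by
  simp only [Matrix.det_apply']
  exact regAt_sum _ (fun (σ : Equiv.Perm (Fin n)) y =>
      ((Equiv.Perm.sign σ : ℤ) : ℂ) * ∏ i, F.1 y (σ i) i) x fun σ _ =>
    M.regAt_mul (M.regAt_const _ x)
      (regAt_prod _ (fun i y => F.1 y (σ i) i) x fun i _ => F.2 x _ _)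

/-- Inverse of an invertible matrix-valued function. -/
noncomputable def inv (F : M.MatrixFunction n) (hF : ∀ y, (F.1 y).det ≠ 0) : M.MatrixFunction n :=
  ⟨fun y => (F.1 y)⁻¹, fun x a b => by
    simp only [Matrix.inv_def, Ring.inverse_eq_inv', Matrix.smul_apply, smul_eq_mul,
      Matrix.adjugate_apply]
    refine M.regAt_mul (M.regAt_inv (regAt_det F x) (hF x)) ?_
    refine regAt_det (n := n) ⟨fun y => (F.1 y).updateRow b (Pi.single a 1), fun x c d => ?_⟩ x
    by_cases hc : c = b
    · subst hc
      simpa using M.regAt_const _ x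
    · simpa [Matrix.updateRow_ne hc] using F.2 x c d⟩

/-- The coordinate function `y ↦ L y` on `S ⊆ V`, for a linear `L : V → Mat`. -/
def coord {V : Type} [AddCommGroup V] [Module ℂ V] (S : Set V)
    (L : V →ₗ[ℂ] Matrix (Fin n) (Fin n) ℂ) : (affine S).MatrixFunction n :=
  ⟨fun y : S => L y, fun x a b =>
    regAt_affine_linear (S := S) ((Matrix.entryLinearMap ℂ ℂ a b).comp L) x⟩

end MatrixFunction

end SpaceWithFunctions

open SpaceWithFunctions

/-! ## The varieties `X`, `Y` and their forms -/

namespace Projectors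

/-- Tuples `(m_1, …, m_n)` of complex `n × n` matrices. -/
abbrev MatTuple (n : ℕ) : Type := Fin n → Matrix (Fin n) (Fin n) ℂ

/-- A projector of rank one. -/
def IsRankOneProjector {n : ℕ} (p : Matrix (Fin n) (Fin n) ℂ) : Prop :=
  p * p = p ∧ p.rank = 1

/-- `X`: complete systems `(p_1, …, p_n)` of pairwise orthogonal rank one projectors. -/
def orthogonalSystems (n : ℕ) : Set (MatTuple n) :=
  {p | (∀ i, IsRankOneProjector (p i)) ∧ ∀ i j, i ≠ j → p i * p j = 0}

/-- `Y`: `n`-tuples of rank one projectors, i.e. the product of `n` copies of the coadjoint orbit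
of rank one projectors in `𝔤𝔩_n ≅ 𝔤𝔩_n^*`. -/
def projectorTuples (n : ℕ) : Set (MatTuple n) :=
  {r | ∀ i, IsRankOneProjector (r i)}

/-- The variety `X`. -/
def X (n : ℕ) : SpaceWithFunctions := affine (orthogonalSystems n)

/-- The variety `Y`. -/
def Y (n : ℕ) : SpaceWithFunctions := affine (projectorTuples n)

/-- The matrix-valued function `r ↦ r_i` on `Y`. -/
def Y.r {n : ℕ} (i : Fin n) : (Y n).MatrixFunction n :=
  MatrixFunction.coord (projectorTuples n) (LinearMap.proj i)

/-- The matrix-valued function `p ↦ p_i` on `X`. -/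
def X.p {n : ℕ} (i : Fin n) : (X n).MatrixFunction n :=
  MatrixFunction.coord (orthogonalSystems n) (LinearMap.proj i)

/-- The scalar 2-form `Tr (dF ∧ dH)`, that is
`(u, v) ↦ Tr (dF(u) dH(v)) - Tr (dF(v) dH(u))`. -/
def traceWedge {M : SpaceWithFunctions} {n : ℕ} (F H : M.MatrixFunction n) : TwoTensor M :=
  fun x => LinearMap.mk₂ ℂ
    (fun u v => (F.d x u * H.d x v).trace - (F.d x v * H.d x u).trace)
    (by intro u u' v; simp only [map_add, add_mul, mul_add, Matrix.trace_add]; ring)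
    (by intro c u v; simp only [map_smul, Matrix.smul_mul, Matrix.mul_smul, Matrix.trace_smul,
          smul_eq_mul]; ring)
    (by intro u v v'; simp only [map_add, add_mul, mul_add, Matrix.trace_add]; ring)
    (by intro c u v; simp only [map_smul, Matrix.smul_mul, Matrix.mul_smul, Matrix.trace_smul,
          smul_eq_mul]; ring)

/-- The symplectic form of `Y`, `ω_Y = Tr ∑ i, r_i dr_i ∧ dr_i`. It is the
Kirillov–Kostant–Souriau form, see `kirillov_eq`. -/
def omegaY (n : ℕ) : TwoTensor (Y n) :=
  fun x => LinearMap.mk₂ ℂ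
    (fun u v => ∑ i, ((Y.r i).1 x *
      ((Y.r i).d x u * (Y.r i).d x v - (Y.r i).d x v * (Y.r i).d x u)).trace)
    (by
      intro u u' v
      rw [← Finset.sum_add_distrib]
      refine Finset.sum_congr rfl fun i _ => ?_
      rw [← Matrix.trace_add, map_add]
      congr 1; noncomm_ring)
    (by
      intro c u v
      rw [Finset.smul_sum]
      refine Finset.sum_congr rfl fun i _ => ?_
      rw [← Matrix.trace_smul, map_smul]
      congr 1; simp only [Matrix.smul_mul, Matrix.mul_smul, smul_sub, mul_sub])
    (by
      intro u v v'
      rw [← Finset.sum_add_distrib]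
      refine Finset.sum_congr rfl fun i _ => ?_
      rw [← Matrix.trace_add, map_add]
      congr 1; noncomm_ring)
    (by
      intro c u v
      rw [Finset.smul_sum]
      refine Finset.sum_congr rfl fun i _ => ?_
      rw [← Matrix.trace_smul, map_smul]
      congr 1; simp only [Matrix.smul_mul, Matrix.mul_smul, smul_sub, mul_sub])

/-- On the tangent vectors `[a, r]`, `[b, r]` of the coadjoint orbit through a projector `r`, the
form `Tr r dr ∧ dr` is `Tr (r [b, a])`, the Kirillov–Kostant–Souriau form. -/
theorem kirillov_eq {n : ℕ} (r a b : Matrix (Fin n) (Fin n) ℂ) (hr : r * r = r) :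
    (r * ((a * r - r * a) * (b * r - r * b) - (b * r - r * b) * (a * r - r * a))).trace =
      (r * (b * a - a * b)).trace := by
  have key : ∀ c d : Matrix (Fin n) (Fin n) ℂ,
      (r * ((c * r - r * c) * (d * r - r * d))).trace =
        (r * c * r * d).trace - (r * c * d).trace := by
    intro c d
    have e : r * ((c * r - r * c) * (d * r - r * d)) =
        r * c * r * d * r - r * c * (r * r) * d - (r * r) * c * d * r
          + (r * r) * c * r * d := by noncomm_ring
    have t1 : (r * c * r * d * r).trace = (r * c * r * d).trace := by
      rw [Matrix.trace_mul_comm]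
      simp only [← mul_assoc, hr]
    have t2 : (r * c * d * r).trace = (r * c * d).trace := by
      rw [Matrix.trace_mul_comm]
      simp only [← mul_assoc, hr]
    rw [e, hr, Matrix.trace_add, Matrix.trace_sub, Matrix.trace_sub, t1, t2]
    ring
  have sym : (r * a * r * b).trace = (r * b * r * a).trace := by
    rw [mul_assoc (r * a), Matrix.trace_mul_comm, ← mul_assoc]
  rw [mul_sub, Matrix.trace_sub, key, key, sym, mul_sub, Matrix.trace_sub,
    ← mul_assoc, ← mul_assoc]
  ring

/-! ## The cotangent bundle `Ω¹X` -/

/-- `X × 𝔸`, where the affine space `𝔸` of tuples of matrices is identified with the space of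
constant 1-forms on itself by `C ↦ ∑ i, Tr (C_i dp_i)`. -/
def ambientForms (n : ℕ) : SpaceWithFunctions :=
  affine (orthogonalSystems n ×ˢ (Set.univ : Set (MatTuple n)))

/-- The matrix-valued function `(p, C) ↦ p_i`. -/
def ambientForms.p {n : ℕ} (i : Fin n) : (ambientForms n).MatrixFunction n :=
  MatrixFunction.coord _ ((LinearMap.proj i).comp (LinearMap.fst ℂ (MatTuple n) (MatTuple n)))

/-- The matrix-valued function `(p, C) ↦ C_i`. -/
def ambientForms.C {n : ℕ} (i : Fin n) : (ambientForms n).MatrixFunction n :=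
  MatrixFunction.coord _ ((LinearMap.proj i).comp (LinearMap.snd ℂ (MatTuple n) (MatTuple n)))

/-- Points of the total space of the cotangent bundle: a point of `X` and a covector there. -/
def Covector (n : ℕ) : Type := Σ p : X n, Module.Dual ℂ ((X n).tangentSpace p)

/-- The restriction map `(p, C) ↦ (∑ i, Tr (C_i dp_i))` from ambient 1-forms to 1-forms on `X`;
this is a surjection `T^*𝔸|_X → Ω¹X` of vector bundles. -/
def restrictForm (n : ℕ) (y : ambientForms n) : Covector n :=
  let p : X n := ⟨y.1.1, y.2.1⟩
  ⟨p, ∑ i, (Matrix.traceLinearMap (Fin n) ℂ ℂ).comp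
    ((LinearMap.mulLeft ℂ (y.1.2 i)).comp ((X.p i).d p))⟩

/-- The total space `Ω¹X` of the cotangent bundle of `X`, a variety as the quotient
of `T^*𝔸|_X`. -/
def cotangentBundle (n : ℕ) : SpaceWithFunctions :=
  (ambientForms n).coinduced (restrictForm n)

/-- The restriction map as a morphism `T^*𝔸|_X → Ω¹X`. -/
def restrictFormMap (n : ℕ) : RegularMap (ambientForms n) (cotangentBundle n) :=
  (ambientForms n).toCoinduced (restrictForm n)

/-- The canonical 2-form `dθ` of `Ω¹X`, `θ` being the tautological 1-form. The pull-back of `θ` to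
`T^*𝔸|_X` is `∑ i, Tr (C_i dp_i)`, so `dθ` is the form whose pull-back is
`∑ i, Tr (dC_i ∧ dp_i)`. -/
def IsCanonicalForm {n : ℕ} (ω : TwoTensor (cotangentBundle n)) : Prop :=
  ∀ y : ambientForms n, TwoTensor.pullback (restrictFormMap n) ω y =
    ∑ i, traceWedge (ambientForms.C i) (ambientForms.p i) y

/-! ## The symplectic reduction of `Ω¹G` by the torus -/

/-- The zero level `{(g, A) : g ∈ GL_n, diag (A g) = 0}` of the moment map
`μ_T (g, A) = diag (A g)` on `Ω¹G = G × Mat`. -/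
def zeroLevel (n : ℕ) : Set (Matrix (Fin n) (Fin n) ℂ × Matrix (Fin n) (Fin n) ℂ) :=
  {z | z.1.det ≠ 0 ∧ (z.2 * z.1).diag = 0}

/-- The variety `μ_T⁻¹(0)`. -/
def Z (n : ℕ) : SpaceWithFunctions := affine (zeroLevel n)

/-- The matrix-valued function `(g, A) ↦ g`. -/
def Z.g {n : ℕ} : (Z n).MatrixFunction n :=
  MatrixFunction.coord (zeroLevel n) (LinearMap.fst ℂ _ _)

/-- The matrix-valued function `(g, A) ↦ A`. -/
def Z.A {n : ℕ} : (Z n).MatrixFunction n :=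
  MatrixFunction.coord (zeroLevel n) (LinearMap.snd ℂ _ _)

/-- The torus `T = (ℂ^*)^n`. -/
abbrev Torus (n : ℕ) : Type := Fin n → ℂˣ

/-- The diagonal matrix of `t ∈ T`. -/
def Torus.diag {n : ℕ} (t : Torus n) : Matrix (Fin n) (Fin n) ℂ :=
  Matrix.diagonal fun i => (t i : ℂ)

theorem Torus.diag_one {n : ℕ} : Torus.diag (1 : Torus n) = 1 := by
  simp [Torus.diag]

theorem Torus.diag_mul {n : ℕ} (s t : Torus n) :
    Torus.diag (s * t) = Torus.diag s * Torus.diag t := by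
  simp [Torus.diag, Matrix.diagonal_mul_diagonal]

theorem Torus.diag_inv_mul {n : ℕ} (t : Torus n) : Torus.diag t⁻¹ * Torus.diag t = 1 := by
  rw [← Torus.diag_mul, inv_mul_cancel, Torus.diag_one]

theorem Torus.diag_mul_inv {n : ℕ} (t : Torus n) : Torus.diag t * Torus.diag t⁻¹ = 1 := by
  rw [← Torus.diag_mul, mul_inv_cancel, Torus.diag_one]

/-- The action `(g, A) ↦ (g t⁻¹, t A)` of `T` on `μ_T⁻¹(0)`. -/
instance torusAction (n : ℕ) : MulAction (Torus n) (Z n) where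
  smul t z := ⟨(z.1.1 * Torus.diag t⁻¹, Torus.diag t * z.1.2), by
    refine ⟨?_, ?_⟩
    · have h := congrArg Matrix.det (Torus.diag_inv_mul t)
      rw [Matrix.det_mul, Matrix.det_one] at h
      change (z.1.1 * Torus.diag t⁻¹).det ≠ 0
      rw [Matrix.det_mul]
      exact mul_ne_zero z.2.1 (left_ne_zero_of_mul_eq_one h)
    · ext i
      have h : (z.1.2 * z.1.1) i i = 0 := congrFun z.2.2 i
      change (Torus.diag t * z.1.2 * (z.1.1 * Torus.diag t⁻¹)) i i = 0
      rw [mul_assoc, ← mul_assoc z.1.2]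
      simp [Torus.diag, Matrix.diagonal_mul, Matrix.mul_diagonal, h]⟩
  one_smul z := by
    apply Subtype.ext
    change (z.1.1 * Torus.diag (1 : Torus n)⁻¹, Torus.diag (1 : Torus n) * z.1.2) = z.1
    rw [inv_one, Torus.diag_one, mul_one, one_mul]
  mul_smul s t z := by
    apply Subtype.ext
    change (z.1.1 * Torus.diag (s * t)⁻¹, Torus.diag (s * t) * z.1.2) =
      (z.1.1 * Torus.diag t⁻¹ * Torus.diag s⁻¹, Torus.diag s * (Torus.diag t * z.1.2))
    rw [mul_inv_rev, Torus.diag_mul, Torus.diag_mul, mul_assoc, mul_assoc]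

/-- The class of a point in `μ_T⁻¹(0)/T`. -/
def orbitClass (n : ℕ) (z : Z n) : MulAction.orbitRel.Quotient (Torus n) (Z n) :=
  Quotient.mk _ z

/-- The symplectic reduction `μ_T⁻¹(0)/T`, with the quotient structure. -/
def reduction (n : ℕ) : SpaceWithFunctions := (Z n).coinduced (orbitClass n)

/-- The quotient map `μ_T⁻¹(0) → μ_T⁻¹(0)/T` as a morphism. -/
def reductionMap (n : ℕ) : RegularMap (Z n) (reduction n) :=
  (Z n).toCoinduced (orbitClass n)

/-! ## The map `φ` -/

/-- The reference system `q_i` of orthogonal projectors of the standard basis. -/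
def q {n : ℕ} (i : Fin n) : Matrix (Fin n) (Fin n) ℂ := Matrix.single i i 1

theorem q_mul_self {n : ℕ} (i : Fin n) : q i * q i = q i := by simp [q]

theorem q_mul_q {n : ℕ} {i j : Fin n} (h : i ≠ j) : q i * q j = 0 := by
  simp [q, h]

theorem rank_q {n : ℕ} (i : Fin n) : (q i).rank = 1 := by
  have h : q i = Matrix.diagonal (Pi.single i (1 : ℂ)) := by
    rw [q, Matrix.diagonal_single]
  classical
  rw [h, Matrix.rank_diagonal, Fintype.card_eq_one_iff]
  refine ⟨⟨i, by simp⟩, fun j => Subtype.ext ?_⟩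
  by_contra hj
  exact j.2 (by simp [hj])

theorem q_mul_mul_q {n : ℕ} (i : Fin n) (B : Matrix (Fin n) (Fin n) ℂ) (h : B.diag = 0) :
    q i * B * q i = 0 := by
  have h' : B i i = 0 := congrFun h i
  simp [q, h']

theorem inv_mul_Z {n : ℕ} (z : Z n) : z.1.1⁻¹ * z.1.1 = 1 :=
  Matrix.nonsing_inv_mul _ (isUnit_iff_ne_zero.mpr z.2.1)

theorem mul_inv_Z {n : ℕ} (z : Z n) : z.1.1 * z.1.1⁻¹ = 1 :=
  Matrix.mul_nonsing_inv _ (isUnit_iff_ne_zero.mpr z.2.1)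

theorem isRankOneProjector_of {n : ℕ} (i : Fin n) (g B : Matrix (Fin n) (Fin n) ℂ)
    (h : q i * (B * g) * q i = q i) : IsRankOneProjector (g * q i * B) := by
  refine ⟨?_, le_antisymm ?_ ?_⟩
  · calc g * q i * B * (g * q i * B) = g * (q i * (B * g) * q i) * B := by noncomm_ring
      _ = g * q i * B := by rw [h]
  · calc (g * q i * B).rank ≤ (g * q i).rank := Matrix.rank_mul_le_left _ _
      _ ≤ (q i).rank := Matrix.rank_mul_le_right _ _
      _ = 1 := rank_q i
  · have h2 : q i = (q i * B) * (g * q i * B) * (g * q i) := by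
      calc q i = q i * (B * g) * q i := h.symm
        _ = q i * (B * g) * (q i * (B * g) * q i) := congrArg (q i * (B * g) * ·) h.symm
        _ = (q i * B) * (g * q i * B) * (g * q i) := by noncomm_ring
    calc 1 = (q i).rank := (rank_q i).symm
      _ = ((q i * B) * (g * q i * B) * (g * q i)).rank := congrArg _ h2
      _ ≤ ((q i * B) * (g * q i * B)).rank := Matrix.rank_mul_le_left _ _
      _ ≤ (g * q i * B).rank := Matrix.rank_mul_le_right _ _

/-- The matrix `p_i = g q_i g⁻¹`. -/
noncomputable def pOf {n : ℕ} (i : Fin n) (z : Z n) : Matrix (Fin n) (Fin n) ℂ :=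
  z.1.1 * q i * z.1.1⁻¹

/-- The matrix `r_i = g q_i g⁻¹ (1 + g A)`. -/
noncomputable def rOf {n : ℕ} (i : Fin n) (z : Z n) : Matrix (Fin n) (Fin n) ℂ :=
  z.1.1 * q i * z.1.1⁻¹ * (1 + z.1.1 * z.1.2)

theorem pOf_mem {n : ℕ} (z : Z n) : (fun i => pOf i z) ∈ orthogonalSystems n := by
  refine ⟨fun i => isRankOneProjector_of i _ _ ?_, fun i j hij => ?_⟩
  · rw [inv_mul_Z, mul_one, q_mul_self]
  · calc pOf i z * pOf j z
        = z.1.1 * (q i * (z.1.1⁻¹ * z.1.1) * q j) * z.1.1⁻¹ := by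
          simp only [pOf]; noncomm_ring
      _ = 0 := by rw [inv_mul_Z, mul_one, q_mul_q hij, mul_zero, zero_mul]

theorem rOf_mem {n : ℕ} (z : Z n) : (fun i => rOf i z) ∈ projectorTuples n := by
  intro i
  have h : rOf i z = z.1.1 * q i * (z.1.1⁻¹ * (1 + z.1.1 * z.1.2)) := by
    simp only [rOf, mul_assoc]
  change IsRankOneProjector (rOf i z)
  rw [h]
  refine isRankOneProjector_of i _ _ ?_
  have e : z.1.1⁻¹ * (1 + z.1.1 * z.1.2) * z.1.1 = 1 + z.1.2 * z.1.1 := by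
    rw [mul_add, mul_one, ← mul_assoc, inv_mul_Z, one_mul, add_mul, inv_mul_Z]
  rw [e, mul_add, mul_one, add_mul, q_mul_self, q_mul_mul_q i _ z.2.2, add_zero]

theorem rOf_smul {n : ℕ} (i : Fin n) (t : Torus n) (z : Z n) : rOf i (t • z) = rOf i z := by
  change (z.1.1 * Torus.diag t⁻¹) * q i * (z.1.1 * Torus.diag t⁻¹)⁻¹ *
      (1 + (z.1.1 * Torus.diag t⁻¹) * (Torus.diag t * z.1.2)) = _
  have h1 : (Torus.diag t⁻¹)⁻¹ = Torus.diag t :=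
    Matrix.inv_eq_right_inv (Torus.diag_inv_mul t)
  have h2 : Torus.diag t⁻¹ * q i = q i * Torus.diag t⁻¹ := by
    ext a b
    simp only [Torus.diag, Matrix.diagonal_mul, Matrix.mul_diagonal, q, Matrix.single_apply]
    split_ifs with h
    · obtain ⟨rfl, rfl⟩ := h; ring
    · simp
  rw [Matrix.mul_inv_rev, h1]
  calc z.1.1 * Torus.diag t⁻¹ * q i * (Torus.diag t * z.1.1⁻¹) *
        (1 + z.1.1 * Torus.diag t⁻¹ * (Torus.diag t * z.1.2))
      = z.1.1 * (Torus.diag t⁻¹ * q i) * Torus.diag t * z.1.1⁻¹ *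
        (1 + z.1.1 * (Torus.diag t⁻¹ * Torus.diag t) * z.1.2) := by simp only [mul_assoc]
    _ = z.1.1 * q i * (Torus.diag t⁻¹ * Torus.diag t) * z.1.1⁻¹ * (1 + z.1.1 * z.1.2) := by
        rw [h2, Torus.diag_inv_mul, mul_one, ← mul_assoc]
        simp only [mul_assoc, Torus.diag_inv_mul]
    _ = rOf i z := by rw [Torus.diag_inv_mul, mul_one]; rfl

theorem matTuple_functional {n : ℕ} (l : MatTuple n →ₗ[ℂ] ℂ) (v : MatTuple n) :
    l v = ∑ i, ∑ a, ∑ b, v i a b * l (Pi.single i (Matrix.single a b 1)) := by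
  conv_lhs => rw [← Finset.univ_sum_single v]
  rw [map_sum]
  refine Finset.sum_congr rfl fun i _ => ?_
  conv_lhs => rw [Matrix.matrix_eq_sum_single (v i)]
  have : ∀ w, l (Pi.single i w) = (l.comp (LinearMap.single ℂ _ i)) w := fun _ => rfl
  simp only [this, map_sum]
  refine Finset.sum_congr rfl fun a _ => Finset.sum_congr rfl fun b _ => ?_
  have e : Matrix.single a b (v i a b) = v i a b • Matrix.single a b (1 : ℂ) := by
    rw [Matrix.smul_single, smul_eq_mul, mul_one]
  rw [e, map_smul, smul_eq_mul]

theorem regAt_functional {M : SpaceWithFunctions} {n : ℕ} (F : Fin n → M.MatrixFunction n)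
    (l : MatTuple n →ₗ[ℂ] ℂ) (x : M) : M.RegAt (fun y => l (fun i => (F i).1 y)) x := by
  have e : (fun y => l (fun i => (F i).1 y)) = fun y => ∑ i, ∑ a, ∑ b, (F i).1 y a b *
      l (Pi.single i (Matrix.single a b 1)) := funext fun y => matTuple_functional l _
  rw [e]
  refine MatrixFunction.regAt_sum _ (fun i y => ∑ a, ∑ b, (F i).1 y a b * _) x fun i _ => ?_
  refine MatrixFunction.regAt_sum _ (fun a y => ∑ b, (F i).1 y a b * _) x fun a _ => ?_
  exact MatrixFunction.regAt_sum _ (fun b y => (F i).1 y a b * _) x fun b _ =>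
    M.regAt_mul ((F i).2 x a b) (M.regAt_const _ x)

/-- The matrix-valued function `(g, A) ↦ g q_i g⁻¹`. -/
noncomputable def Z.p {n : ℕ} (i : Fin n) : (Z n).MatrixFunction n :=
  (Z.g.mul (.const _ (q i))).mul (Z.g.inv fun z => z.2.1)

/-- The projection `μ_T⁻¹(0) → X = G/T`, `(g, A) ↦ (g q_i g⁻¹)_i`. -/
noncomputable def baseMap (n : ℕ) : RegularMap (Z n) (X n) :=
  RegularMap.mkAffine (S := orthogonalSystems n) (fun z => ⟨fun i => pOf i z, pOf_mem z⟩)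
    fun l x => regAt_functional (fun i => Z.p i) l x

/-- The morphism `μ_T⁻¹(0) → Y`, `(g, A) ↦ (g q_i g⁻¹ (1 + g A))_i`. -/
noncomputable def phiLevel (n : ℕ) : RegularMap (Z n) (Y n) :=
  RegularMap.mkAffine (S := projectorTuples n) (fun z => ⟨fun i => rOf i z, rOf_mem z⟩)
    fun l x => regAt_functional
      (fun i => (Z.p i).mul ((MatrixFunction.const _ 1).add (Z.g.mul Z.A))) l x

/-- The morphism `φ : μ_T⁻¹(0)/T → Y` induced by
`r_i = g q_i g⁻¹ (1 + g A)`. -/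
noncomputable def phi (n : ℕ) : RegularMap (reduction n) (Y n) :=
  descend (orbitClass n) (phiLevel n)
    (Quotient.lift (phiLevel n) (by
      intro z w h
      obtain ⟨t, rfl⟩ := h
      apply Subtype.ext
      funext i
      exact rOf_smul i t w))
    (fun _ => rfl)

/-- The standard identification of `μ_T⁻¹(0)/T` with `Ω¹X`: the class of `(g, A)` corresponds to the
covector `ξ` at `p = (g q_i g⁻¹)_i` whose pull-back to `μ_T⁻¹(0)` is `Tr (A dg)`. -/
def IsCotangentIdentification {n : ℕ}
    (ι : RegularEquiv (reduction n) (cotangentBundle n)) : Prop :=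
  ∀ z : Z n, ∃ ξ : Module.Dual ℂ ((X n).tangentSpace (baseMap n z)),
    ι.toMap (reductionMap n z) = (⟨baseMap n z, ξ⟩ : Covector n) ∧
    ∀ u : (Z n).tangentSpace z,
      ξ ((baseMap n).tangentMap z u) = ((Z.A).1 z * (Z.g).d z u).trace

/-- A form on `Ω¹X ≅ μ_T⁻¹(0)/T` is the reduction of the form `Tr (dA ∧ dg)` on `Ω¹G`: its pull-back
to `μ_T⁻¹(0)` is the restriction of `Tr (dA ∧ dg)`. -/
def IsReducedForm {n : ℕ} (ι : RegularEquiv (reduction n) (cotangentBundle n))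
    (ω : TwoTensor (cotangentBundle n)) : Prop :=
  TwoTensor.pullback (ι.toMap.comp (reductionMap n)) ω = traceWedge Z.A Z.g

end Projectors

/-!
The idea is to write everything in terms of the gauge invariant pair `(p, B)`, where
`p_i = g q_i g⁻¹` and `B = g A`; the moment map equation reads `p_i B p_i = 0`.

A tangent vector of `X` at `p` has the form `([γ, p_i])_i` (`exists_generator`), and all `γ` occur
(`exists_tangentSpace_conjugation`). The covector `∑ Tr (C_i dp_i)` takes the value `Tr (γ B)` on
it, where `B = ∑ [p_i, C_i]` satisfies `p_i B p_i = 0`. So a point of `Ω¹X` is a pair `(p, B)`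
(`restrictForm_eq_iff`, `restrictForm_surjective`). As `C_i = - g A p_i` gives `B = g A`, the
morphism `(g, A) ↦ (p, (- g A p_i)_i)` induces `μ_T⁻¹(0)/T → Ω¹X`, and `Tr (γ B) = Tr (A dg)` for
`γ = dg g⁻¹`.

The map `φ` is an open embedding of `μ_T⁻¹(0)/T`: it is injective, since the images of the `r_i` are
spanned by the columns of `g`, which are thus determined up to the torus, and
`q_i (g⁻¹ + A) = q_i g⁻¹ r_i` then determines `A`; and the same formulas, applied to
`g = ∑ r_i g₀ q_i`, give sections over the open set on which this matrix is invertible (`isLocalSectionAt_levelSection`). The inverse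
of `μ_T⁻¹(0)/T → Ω¹X` needs no further local sections: it is the lift of `(p, C) ↦ (p_i (1 + B))_i`
along the open embedding `φ`.

For the forms, `sum_trace_projector_form` expresses `∑ Tr r_i dr_i ∧ dr_i`, for `r_i = p_i R`,
through `dR` and the generators `γ` of `dp`. With `R = 1 + B`, this gives `Tr dA ∧ dg` on
`μ_T⁻¹(0)`, where `γ = dg g⁻¹`, and `∑ Tr dC_i ∧ dp_i` on ambient covectors. A form on `Ω¹X` is
determined by its pull-back to either of these spaces, since the local sections split the
differentials of the morphisms to `Ω¹X`.
-/

/-! ### Tangent vectors and germs -/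

namespace SpaceWithFunctions

variable {M N K : SpaceWithFunctions}

/-- A tangent vector only sees germs: multiply `f - g` by the indicator function of `W`, which is
regular at `x`. -/
theorem tangentSpace_congr {x : M} (D : M.tangentSpace x) (f g : M.regularAt x) {W : Set M}
    (hW : IsOpen[M.top] W) (hx : x ∈ W) (h : ∀ y ∈ W, (f : M → ℂ) y = (g : M → ℂ) y) :
    D.1 f = D.1 g := by
  classical
  let χ : M.regularAt x := ⟨fun y => if y ∈ W then 1 else 0,
    M.regAt_congr hW hx (fun y hy => by simp [hy]) (M.regAt_const 1 x)⟩
  have h0 : (f - g) * χ = 0 := by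
    apply Subtype.ext
    funext y
    by_cases hy : y ∈ W
    · simp [h y hy]
    · simp [χ, hy]
  have h1 := D.2 (f - g) χ
  have h2 : ((χ : M.regularAt x) : M → ℂ) x = 1 := by simp [χ, hx]
  have h3 : ((f - g : M.regularAt x) : M → ℂ) x = 0 := by simp [h x hx]
  rw [h0, map_zero, h2, h3, zero_mul, zero_add, one_mul, map_sub] at h1
  exact (sub_eq_zero.mp h1.symm)

theorem tangentSpace_apply_algebraMap {x : M} (D : M.tangentSpace x) (c : ℂ) :
    D.1 (algebraMap ℂ (M.regularAt x) c) = 0 := by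
  have h := D.2 1 1
  have h1 : ((1 : M.regularAt x) : M → ℂ) x = 1 := rfl
  rw [mul_one, h1, one_mul, left_eq_add] at h
  rw [Algebra.algebraMap_eq_smul_one, map_smul, h, smul_zero]

/-! ### Maps that are regular at a point -/

/-- A map of sets `s : N → M` is regular at `y` when it is continuous at `y` and pulls functions
that are regular at `s y` back to functions that are regular at `y`. Outside a neighbourhood of `y`
the map is arbitrary, so local sections of morphisms can be encoded by total functions. -/
def IsRegularMapAt (s : N → M) (y : N) : Prop :=
  (∀ V : Set M, IsOpen[M.top] V → s y ∈ V →
    ∃ W : Set N, IsOpen[N.top] W ∧ y ∈ W ∧ ∀ w ∈ W, s w ∈ V) ∧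
  ∀ f : M → ℂ, M.RegAt f (s y) → N.RegAt (fun w => f (s w)) y

/-- The map `s` is a section of `π` near `y`. -/
def IsLocalSectionAt (π : M → N) (s : N → M) (y : N) : Prop :=
  IsRegularMapAt s y ∧ ∃ W : Set N, IsOpen[N.top] W ∧ y ∈ W ∧ ∀ w ∈ W, π (s w) = w

theorem RegularMap.isRegularMapAt (φ : RegularMap M N) (x : M) : IsRegularMapAt φ x :=
  ⟨fun V hV hx => ⟨φ ⁻¹' V, φ.isOpen_preimage V hV, hx, fun _ h => h⟩, fun _ hf => φ.regAt_comp hf⟩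

theorem IsRegularMapAt.comp {s : N → M} {t : K → N} {z : K} (hs : IsRegularMapAt s (t z))
    (ht : IsRegularMapAt t z) : IsRegularMapAt (fun w => s (t w)) z := by
  refine ⟨fun V hV hz => ?_, fun f hf => ht.2 _ (hs.2 f hf)⟩
  obtain ⟨W, hW, hzW, h⟩ := hs.1 V hV hz
  obtain ⟨W', hW', hzW', h'⟩ := ht.1 W hW hzW
  exact ⟨W', hW', hzW', fun w hw => h _ (h' w hw)⟩

/-- The differential of a local section splits the differential of the morphism. -/
theorem IsLocalSectionAt.tangentMap_surjective {π : RegularMap M N} {s : N → M} {x : M}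
    (hs : IsLocalSectionAt π s (π x)) (hsx : s (π x) = x) :
    Function.Surjective (π.tangentMap x) := by
  obtain ⟨⟨-, hs⟩, W, hW, hxW, hπ⟩ := hs
  rw [hsx] at hs
  intro D
  -- `E` is the image of `D` under the differential of the section `s`.
  let E : M.tangentSpace x := ⟨
    { toFun := fun f => D.1 ⟨fun y => (f : M → ℂ) (s y), hs _ f.2⟩
      map_add' := fun f g => D.1.map_add ⟨fun y => (f : M → ℂ) (s y), hs _ f.2⟩
        ⟨fun y => (g : M → ℂ) (s y), hs _ g.2⟩
      map_smul' := fun c f => D.1.map_smul c ⟨fun y => (f : M → ℂ) (s y), hs _ f.2⟩ },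
    fun f g => by
      have h := D.2 ⟨fun y => (f : M → ℂ) (s y), hs _ f.2⟩ ⟨fun y => (g : M → ℂ) (s y), hs _ g.2⟩
      simp only [hsx] at h
      exact h⟩
  refine ⟨E, Subtype.ext (LinearMap.ext fun f => ?_)⟩
  exact tangentSpace_congr D _ f hW hxW fun y hy => congrArg (f : N → ℂ) (hπ y hy)

/-! ### Open embeddings -/

namespace RegularMap

theorem ext {φ ψ : RegularMap M N} (h : ∀ x, φ x = ψ x) : φ = ψ := by
  cases φ
  cases ψ
  congr
  exact funext h

/-- An injective morphism with local sections through all points of the source is an open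
embedding. -/
theorem isOpenEmbedding_of_localSections (φ : RegularMap M N) (hφ : Function.Injective φ)
    (h : ∀ x, ∃ s : N → M, IsLocalSectionAt φ s (φ x) ∧ s (φ x) = x) : φ.IsOpenEmbedding := by
  let _ := M.top
  let _ := N.top
  refine ⟨.of_continuous_injective_isOpenMap ⟨φ.isOpen_preimage⟩ hφ fun U hU => ?_, ?_⟩
  · rw [isOpen_iff_forall_mem_open]
    rintro _ ⟨x, hx, rfl⟩
    obtain ⟨s, ⟨hs, W, hW, hxW, hsec⟩, hsx⟩ := h x
    obtain ⟨W', hW', hxW', hs'⟩ := hs.1 U hU (by rwa [hsx])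
    exact ⟨W ∩ W', fun y hy => ⟨s y, hs' y hy.2, hsec y hy.1⟩, hW.inter hW', hxW, hxW'⟩
  · intro f x hf
    obtain ⟨s, ⟨hs, W, hW, hxW, hsec⟩, hsx⟩ := h x
    exact N.regAt_congr hW hxW (fun y hy => congrArg f (hsec y hy)) (hs.2 _ (by rwa [hsx]))

theorem IsOpenEmbedding.injective {φ : RegularMap M N} (hφ : φ.IsOpenEmbedding) :
    Function.Injective φ := by
  let _ := M.top
  let _ := N.top
  exact hφ.1.injective

/-- A morphism into the image of an open embedding lifts along the open embedding. -/
noncomputable def IsOpenEmbedding.lift {φ : RegularMap M N} (hφ : φ.IsOpenEmbedding)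
    (ψ : RegularMap K N) (h : ∀ k, ∃ m, φ m = ψ k) : RegularMap K M where
  toFun k := (h k).choose
  isOpen_preimage := by
    intro W hW
    let _ := M.top
    let _ := N.top
    have e : (fun k => (h k).choose) ⁻¹' W = ψ ⁻¹' (φ '' W) := by
      ext k
      refine ⟨fun hk => ⟨_, hk, (h k).choose_spec⟩, ?_⟩
      rintro ⟨m, hm, hmk⟩
      have hm' : m = (h k).choose := hφ.injective (hmk.trans (h k).choose_spec.symm)
      change (h k).choose ∈ W
      rwa [← hm']
    rw [e]
    exact ψ.isOpen_preimage _ (hφ.1.isOpenMap W hW)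
  regAt_comp := by
    intro f k hf
    -- `F` is the function `f`, transported to the image of `φ` and extended by zero.
    let F : N → ℂ := Function.extend φ f 0
    have hF : ∀ m, F (φ m) = f m := fun m => hφ.injective.extend_apply f 0 m
    have h1 : N.RegAt F (φ (h k).choose) := by
      refine hφ.2 F _ ?_
      simpa only [hF] using hf
    rw [(h k).choose_spec] at h1
    have h2 := ψ.regAt_comp h1
    have e : (fun k => F (ψ k)) = fun k => f (h k).choose := by
      funext k
      rw [← hF, (h k).choose_spec]
    rwa [e] at h2

theorem IsOpenEmbedding.apply_lift {φ : RegularMap M N} (hφ : φ.IsOpenEmbedding)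
    (ψ : RegularMap K N) (h : ∀ k, ∃ m, φ m = ψ k) (k : K) : φ (hφ.lift ψ h k) = ψ k :=
  (h k).choose_spec

/-- Open embeddings are preserved by composition with isomorphisms. -/
theorem IsOpenEmbedding.comp_invMap {φ : RegularMap M N} (hφ : φ.IsOpenEmbedding)
    (e : RegularEquiv M K) : (φ.comp e.invMap).IsOpenEmbedding := by
  let _ := M.top
  let _ := N.top
  let _ := K.top
  constructor
  · let h : K ≃ₜ M :=
      { toFun := e.invMap
        invFun := e.toMap
        left_inv := e.right_inv
        right_inv := e.left_inv
        continuous_toFun := ⟨e.invMap.isOpen_preimage⟩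
        continuous_invFun := ⟨e.toMap.isOpen_preimage⟩ }
    exact hφ.1.comp h.isOpenEmbedding
  · intro f k hk
    rw [← e.right_inv k] at hk
    have h := e.toMap.regAt_comp hk
    refine hφ.2 f (e.invMap k) ?_
    change M.RegAt (fun m => f (φ (e.invMap (e.toMap m)))) _ at h
    simpa only [e.left_inv] using h

end RegularMap

/-! ### Pull-back of forms -/

theorem TwoTensor.pullback_comp {M N K : SpaceWithFunctions} (ψ : RegularMap N K)
    (φ : RegularMap M N) (ω : TwoTensor K) :
    TwoTensor.pullback (ψ.comp φ) ω = TwoTensor.pullback φ (TwoTensor.pullback ψ ω) :=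
  rfl

/-- A form is determined at `φ x` by its pull-back along a morphism `φ` that is submersive
at `x`. -/
theorem TwoTensor.eq_of_pullback_eq {M N : SpaceWithFunctions} {φ : RegularMap M N}
    {ω ω' : TwoTensor N} {x : M} (hφ : Function.Surjective (φ.tangentMap x))
    (h : TwoTensor.pullback φ ω x = TwoTensor.pullback φ ω' x) : ω (φ x) = ω' (φ x) := by
  refine LinearMap.ext₂ fun u v => ?_
  obtain ⟨u, rfl⟩ := hφ u
  obtain ⟨v, rfl⟩ := hφ v
  exact LinearMap.congr_fun₂ h u v

/-! ### Tangent vectors and regular maps of subvarieties of vector spaces -/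

section Affine

variable {V : Type} [AddCommGroup V] [Module ℂ V] {S : Set V}

/-- The function on `S` defined by a polynomial function, as an element of the algebra of functions
that are regular at `x`. -/
def regularOfPolynomial {P : V → ℂ} (hP : P ∈ polynomialFunctions V) (x : S) :
    (affine S).regularAt x :=
  ⟨fun y : S => P y, regAt_affine_of_mem hP x⟩

/-- A tangent vector of a subvariety of a vector space is determined by its values on the linear
functions. -/
theorem tangentSpace_affine_ext {x : S} {D E : (affine S).tangentSpace x}
    (h : ∀ l : V →ₗ[ℂ] ℂ, D.1 ⟨fun y : S => l y, regAt_affine_linear l x⟩ =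
      E.1 ⟨fun y : S => l y, regAt_affine_linear l x⟩) : D = E := by
  have key : ∀ (P : V → ℂ) (hP : P ∈ polynomialFunctions V),
      D.1 (regularOfPolynomial hP x) = E.1 (regularOfPolynomial hP x) := by
    intro P hP
    induction hP using Algebra.adjoin_induction with
    | mem P hP => obtain ⟨l, rfl⟩ := hP; exact h l
    | algebraMap c =>
      exact (tangentSpace_apply_algebraMap (M := affine S) D c).trans
        (tangentSpace_apply_algebraMap (M := affine S) E c).symm
    | add P Q hP hQ h h' =>
      have e : regularOfPolynomial (add_mem hP hQ) x =
        regularOfPolynomial hP x + regularOfPolynomial hQ x := rfl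
      rw [e, map_add, map_add, h, h']
    | mul P Q hP hQ h h' =>
      have e : regularOfPolynomial (mul_mem hP hQ) x =
        regularOfPolynomial hP x * regularOfPolynomial hQ x := rfl
      rw [e, D.2, E.2, h, h']
  refine Subtype.ext (LinearMap.ext fun f => ?_)
  obtain ⟨P, hP, Q, hQ, hQx, hf⟩ := f.2
  -- Apply the Leibniz rule to `f * Q = P`, an identity that holds near `x`.
  have hg : ∀ F : (affine S).tangentSpace x,
      F.1 (f * regularOfPolynomial hQ x) = F.1 (regularOfPolynomial hP x) := fun F =>
    tangentSpace_congr (M := affine S) F _ _ (isOpen_zariski_basic hQ) hQx fun y hy => by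
      change f.1 y * Q y.1 = P y.1
      rw [hf y hy]
      exact div_mul_cancel₀ _ hy
  have h1 := hg D
  have h2 := hg E
  rw [D.2] at h1
  rw [E.2] at h2
  have hQx' : (regularOfPolynomial hQ x).1 x ≠ 0 := hQx
  have h3 : (regularOfPolynomial hQ x).1 x * D.1 f =
      (regularOfPolynomial hQ x).1 x * E.1 f := by
    refine add_left_cancel (h1.trans ?_)
    rw [key, ← h2, key]
  exact mul_left_cancel₀ hQx' h3

theorem differentiable_polynomialFunctions_line {P : V → ℂ} (hP : P ∈ polynomialFunctions V)
    (x v : V) : Differentiable ℂ fun t : ℂ => P (x + t • v) := by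
  induction hP using Algebra.adjoin_induction with
  | mem P hP =>
    obtain ⟨l, rfl⟩ := hP
    simp only [map_add, map_smul, smul_eq_mul]
    fun_prop
  | algebraMap c => exact differentiable_const c
  | add P Q _ _ h h' => exact h.add h'
  | mul P Q _ _ h h' => exact h.mul h'

/-- A line through `x` that stays in `S` near `x` has a velocity vector, a tangent vector of `S`. -/
theorem exists_tangentSpace_of_line (x : S) (v : V) (h : ∀ᶠ t : ℂ in 𝓝 0, x.1 + t • v ∈ S) :
    ∃ D : (affine S).tangentSpace x, ∀ l : V →ₗ[ℂ] ℂ,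
      D.1 ⟨fun y : S => l y, regAt_affine_linear l x⟩ = l v := by
  classical
  let c : ℂ → S := fun t => if h : x.1 + t • v ∈ S then ⟨x.1 + t • v, h⟩ else x
  have hc : ∀ᶠ t in 𝓝 0, (c t).1 = x.1 + t • v := h.mono fun t ht => by simp [c, ht]
  have hc0 : c 0 = x := Subtype.ext (by simp [c])
  have hd : ∀ f : (affine S).regularAt x, DifferentiableAt ℂ (fun t => f.1 (c t)) 0 := by
    rintro ⟨f, P, hP, Q, hQ, hQx, hf⟩
    have dP := (differentiable_polynomialFunctions_line hP x.1 v) 0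
    have dQ := (differentiable_polynomialFunctions_line hQ x.1 v) 0
    have hQ0 : Q (x.1 + (0 : ℂ) • v) ≠ 0 := by simpa using hQx
    refine (dP.div dQ hQ0).congr_of_eventuallyEq ?_
    filter_upwards [hc, dQ.continuousAt.eventually_ne hQ0] with t ht hQt
    change f (c t) = P (x.1 + t • v) / Q (x.1 + t • v)
    rw [hf _ (by rwa [ht]), ht]
  refine ⟨⟨
    { toFun := fun f => deriv (fun t => f.1 (c t)) 0
      map_add' := fun f g => deriv_fun_add (hd f) (hd g)
      map_smul' := fun a f => deriv_const_mul a (hd f) }, fun f g => ?_⟩, fun l => ?_⟩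
  · have := deriv_fun_mul (hd f) (hd g)
    rw [hc0] at this
    refine this.trans ?_
    change deriv _ 0 * _ + _ * deriv _ 0 = _ * deriv _ 0 + _ * deriv _ 0
    ring
  · change deriv (fun t => l (c t)) 0 = l v
    have e : (fun t => l (c t)) =ᶠ[𝓝 0] fun t => l x.1 + t * l v :=
      hc.mono fun t ht => by
        change l (c t).1 = _
        rw [ht, map_add, map_smul, smul_eq_mul]
    rw [e.deriv_eq]
    simp

/-- A map to a subvariety of a vector space whose coordinates are regular at a point is regular at
this point. -/
theorem isRegularMapAt_affine {M : SpaceWithFunctions} (s : M → affine S) (y : M)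
    (h : ∀ l : V →ₗ[ℂ] ℂ, M.RegAt (fun w => l (s w).1) y) : IsRegularMapAt s y := by
  have key : ∀ P ∈ polynomialFunctions V, M.RegAt (fun w => P (s w).1) y := by
    intro P hP
    induction hP using Algebra.adjoin_induction with
    | mem P hP => obtain ⟨l, rfl⟩ := hP; exact h l
    | algebraMap c => exact M.regAt_const c y
    | add P Q _ _ h h' => exact M.regAt_add h h'
    | mul P Q _ _ h h' => exact M.regAt_mul h h'
  have cont : ∀ W : Set S, IsOpen[zariski S] W → s y ∈ W →
      ∃ U : Set M, IsOpen[M.top] U ∧ y ∈ U ∧ ∀ w ∈ U, s w ∈ W := by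
    intro W hW hy
    obtain ⟨P, hP, hPy, hPW⟩ := exists_basic_of_isOpen_zariski hW hy
    obtain ⟨U, hU, hyU, hne⟩ := M.regAt_ne (key P hP) hPy
    exact ⟨U, hU, hyU, fun w hw => hPW _ (hne w hw)⟩
  refine ⟨cont, ?_⟩
  rintro f ⟨P, hP, Q, hQ, hQy, hf⟩
  obtain ⟨U, hU, hyU, hUQ⟩ := cont _ (isOpen_zariski_basic hQ) hQy
  refine M.regAt_congr hU hyU (fun w hw => ?_) (M.regAt_mul (key P hP) (M.regAt_inv (key Q hQ) hQy))
  rw [hf _ (hUQ w hw), div_eq_mul_inv]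

end Affine

/-! ### Differentials of matrix-valued functions -/

namespace MatrixFunction

variable {M N : SpaceWithFunctions} {n : ℕ}

/-- Finite sums of matrix-valued functions. -/
def sum {ι : Type} [Fintype ι] (F : ι → M.MatrixFunction n) : M.MatrixFunction n :=
  ⟨fun y => ∑ i, (F i).1 y, fun x a b => by
    simp only [Matrix.sum_apply]
    exact regAt_sum _ (fun i y => (F i).1 y a b) x fun i _ => (F i).2 x a b⟩

/-- The commutator of matrix-valued functions. -/
def commutator (F H : M.MatrixFunction n) : M.MatrixFunction n :=
  (F.mul H).add (((const M (-1)).mul H).mul F)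

theorem commutator_val (F H : M.MatrixFunction n) (y : M) :
    (F.commutator H).1 y = F.1 y * H.1 y - H.1 y * F.1 y := by
  change F.1 y * H.1 y + -1 * H.1 y * F.1 y = _
  rw [neg_one_mul, neg_mul, sub_eq_add_neg]

variable (F H : M.MatrixFunction n) {x : M} (u : M.tangentSpace x)

theorem d_const (C : Matrix (Fin n) (Fin n) ℂ) : (const M C).d x u = 0 := by
  ext a b
  exact tangentSpace_apply_algebraMap u (C a b)

theorem d_add : (F.add H).d x u = F.d x u + H.d x u := by
  ext a b
  exact u.1.map_add ⟨fun y => F.1 y a b, F.2 x a b⟩ ⟨fun y => H.1 y a b, H.2 x a b⟩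

theorem tangentSpace_apply_sum {ι : Type} [Fintype ι] (f : ι → M → ℂ) (hf : ∀ i, M.RegAt (f i) x)
    (h : M.RegAt (fun y => ∑ i, f i y) x) :
    u.1 ⟨fun y => ∑ i, f i y, h⟩ = ∑ i, u.1 ⟨f i, hf i⟩ := by
  rw [← map_sum]
  congr 1
  apply Subtype.ext
  funext y
  simp

theorem d_sum {ι : Type} [Fintype ι] (F : ι → M.MatrixFunction n) :
    (sum F).d x u = ∑ i, (F i).d x u := by
  ext a b
  have h : M.RegAt (fun y => ∑ i, (F i).1 y a b) x :=
    regAt_sum _ (fun i y => (F i).1 y a b) x fun i _ => (F i).2 x a b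
  have e := tangentSpace_apply_sum u (fun i y => (F i).1 y a b) (fun i => (F i).2 x a b) h
  rw [Matrix.sum_apply]
  refine Eq.trans ?_ e
  change u.1 _ = u.1 _
  congr 1
  apply Subtype.ext
  funext y
  exact Matrix.sum_apply a b _ _

/-- The Leibniz rule. -/
theorem d_mul : (F.mul H).d x u = F.d x u * H.1 x + F.1 x * H.d x u := by
  ext a b
  have h : M.RegAt (fun y => ∑ c, F.1 y a c * H.1 y c b) x :=
    regAt_sum _ (fun c y => F.1 y a c * H.1 y c b) x
      fun c _ => M.regAt_mul (F.2 x a c) (H.2 x c b)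
  have e := tangentSpace_apply_sum u (fun c y => F.1 y a c * H.1 y c b)
    (fun c => M.regAt_mul (F.2 x a c) (H.2 x c b)) h
  have e1 : ∀ c, u.1 ⟨fun y => F.1 y a c * H.1 y c b, M.regAt_mul (F.2 x a c) (H.2 x c b)⟩ =
      F.1 x a c * H.d x u c b + H.1 x c b * F.d x u a c := fun c =>
    u.2 ⟨fun y => F.1 y a c, F.2 x a c⟩ ⟨fun y => H.1 y c b, H.2 x c b⟩
  rw [Matrix.add_apply, Matrix.mul_apply, Matrix.mul_apply, ← Finset.sum_add_distrib]
  refine Eq.trans ?_ (e.trans (Finset.sum_congr rfl fun c _ => (e1 c).trans ?_))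
  · change u.1 _ = u.1 _
    congr 1
  · ring

theorem d_commutator : (F.commutator H).d x u =
    F.d x u * H.1 x - H.1 x * F.d x u + (F.1 x * H.d x u - H.d x u * F.1 x) := by
  have e : (F.commutator H).d x u = F.d x u * H.1 x + F.1 x * H.d x u +
      ((0 * H.1 x + -1 * H.d x u) * F.1 x + -1 * H.1 x * F.d x u) := by
    rw [commutator, d_add, d_mul, d_mul, d_mul, d_const]
    rfl
  rw [e]
  noncomm_ring

theorem d_congr {F H : M.MatrixFunction n} (h : ∀ y, F.1 y = H.1 y) : F.d x u = H.d x u := by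
  rw [show F = H from Subtype.ext (funext h)]

/-- Pointwise version of `MatrixFunction.inv`: the inverse matrix is regular at all points where
the matrix is regular and invertible. -/
theorem regAt_nonsing_inv {F : M → Matrix (Fin n) (Fin n) ℂ} {x : M}
    (hF : ∀ a b, M.RegAt (fun y => F y a b) x) (hx : (F x).det ≠ 0) (a b : Fin n) :
    M.RegAt (fun y => (F y)⁻¹ a b) x := by
  have hdet : ∀ F : M → Matrix (Fin n) (Fin n) ℂ, (∀ a b, M.RegAt (fun y => F y a b) x) →
      M.RegAt (fun y => (F y).det) x := by
    intro F hF
    simp only [Matrix.det_apply']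
    exact regAt_sum _ (fun (σ : Equiv.Perm (Fin n)) y =>
        ((Equiv.Perm.sign σ : ℤ) : ℂ) * ∏ i, F y (σ i) i) x fun σ _ =>
      M.regAt_mul (M.regAt_const _ x)
        (regAt_prod _ (fun i y => F y (σ i) i) x fun i _ => hF _ _)
  simp only [Matrix.inv_def, Ring.inverse_eq_inv', Matrix.smul_apply, smul_eq_mul,
    Matrix.adjugate_apply]
  refine M.regAt_mul (M.regAt_inv (hdet F hF) hx) ?_
  refine hdet (fun y => (F y).updateRow b (Pi.single a 1)) fun c d => ?_
  by_cases hc : c = b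
  · subst hc
    simpa using M.regAt_const _ x
  · simpa [Matrix.updateRow_ne hc] using hF c d

theorem regAt_matrix_mul {F H : M → Matrix (Fin n) (Fin n) ℂ} {x : M}
    (hF : ∀ a b, M.RegAt (fun y => F y a b) x) (hH : ∀ a b, M.RegAt (fun y => H y a b) x)
    (a b : Fin n) : M.RegAt (fun y => (F y * H y) a b) x := by
  simp only [Matrix.mul_apply]
  exact regAt_sum _ (fun c y => F y a c * H y c b) x fun c _ => M.regAt_mul (hF a c) (hH c b)

theorem regAt_matrix_functional {F : M → Matrix (Fin n) (Fin n) ℂ} {x : M}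
    (hF : ∀ a b, M.RegAt (fun y => F y a b) x) (l : Matrix (Fin n) (Fin n) ℂ →ₗ[ℂ] ℂ) :
    M.RegAt (fun y => l (F y)) x := by
  have e : ∀ y, l (F y) = ∑ a, ∑ b, F y a b * l (Matrix.single a b 1) := fun y => by
    conv_lhs => rw [Matrix.matrix_eq_sum_single (F y)]
    simp only [map_sum]
    refine Finset.sum_congr rfl fun a _ => Finset.sum_congr rfl fun b _ => ?_
    rw [← smul_eq_mul, ← map_smul, Matrix.smul_single, smul_eq_mul, mul_one]
  simp only [e]
  refine regAt_sum _ (fun a y => ∑ b, F y a b * l (Matrix.single a b 1)) x fun a _ => ?_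
  exact regAt_sum _ (fun b y => F y a b * l (Matrix.single a b 1)) x fun b _ =>
    M.regAt_mul (hF a b) (M.regAt_const _ x)

end MatrixFunction

end SpaceWithFunctions

namespace Projectors

/-! ### Trace identities -/

section Trace

variable {n : ℕ}

/-- The form `Tr r dr ∧ dr` at the rank one projector `r = p R`, on the tangent vectors for which
`dp` is `[γ, p]`, resp. `[δ, p]`, and `dR` is `β`, resp. `ε`. For `r = x y` with a column `x` and a
row `y` such that `y x = 1`, this is the identity `Tr r dr ∧ dr = dy ∧ dx`, as `p` plays the role
of `x` with `dx = γ p`, and `p R` that of `y` with `dy = p (β - γ R)`. -/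
theorem trace_projector_form {p R γ β δ ε : Matrix (Fin n) (Fin n) ℂ} (hp : p * p = p)
    (hR : p * R * p = p) (hβ : p * β * p = p * (γ * R - R * γ) * p)
    (hε : p * ε * p = p * (δ * R - R * δ) * p) :
    (p * R * (((γ * p - p * γ) * R + p * β) * ((δ * p - p * δ) * R + p * ε) -
      ((δ * p - p * δ) * R + p * ε) * ((γ * p - p * γ) * R + p * β))).trace =
    (p * ((β - γ * R) * δ - (ε - δ * R) * γ)).trace := by
  have T : ∀ Y : Matrix (Fin n) (Fin n) ℂ, (p * Y * p * R).trace = (p * Y).trace := fun Y => by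
    rw [show p * Y * p * R = (p * Y) * (p * R) by noncomm_ring, Matrix.trace_mul_comm,
      ← mul_assoc, hR]
  -- The last summand is symmetric, by cyclicity of the trace, and drops out of the alternating
  -- expression.
  have key : ∀ γ β δ ε : Matrix (Fin n) (Fin n) ℂ, p * β * p = p * (γ * R - R * γ) * p →
      p * ε * p = p * (δ * R - R * δ) * p →
      (p * R * (((γ * p - p * γ) * R + p * β) * ((δ * p - p * δ) * R + p * ε))).trace =
        (p * ((β - γ * R) * δ)).trace +
          ((p * (β - γ * R) * p) * (p * (ε - δ * R) * p)).trace := by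
    intro γ β δ ε hβ hε
    have ha : p * R * γ * p = -(p * (β - γ * R) * p) := by
      rw [mul_sub, sub_mul, hβ]; noncomm_ring
    have ha' : p * R * δ * p = -(p * (ε - δ * R) * p) := by
      rw [mul_sub, sub_mul, hε]; noncomm_ring
    have e1 : p * R * ((γ * p - p * γ) * R + p * β) = p * (β - γ * R) * (1 - p * R) := by
      calc p * R * ((γ * p - p * γ) * R + p * β)
          = (p * R * γ * p) * R + (p * R * p) * (β - γ * R) := by noncomm_ring
        _ = _ := by rw [ha, hR]; noncomm_ring
    have e2 : p * (β - γ * R) * (1 - p * R) * p = 0 := by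
      calc p * (β - γ * R) * (1 - p * R) * p
          = p * (β - γ * R) * p - p * (β - γ * R) * (p * R * p) := by noncomm_ring
        _ = 0 := by rw [hR, sub_self]
    have e3 : p * R * (((γ * p - p * γ) * R + p * β) * ((δ * p - p * δ) * R + p * ε)) =
        p * ((β - γ * R) * δ) * p * R - p * ((β - γ * R) * (p * R * δ)) * p * R := by
      calc _ = p * R * ((γ * p - p * γ) * R + p * β) * ((δ * p - p * δ) * R + p * ε) := by
            rw [mul_assoc (p * R)]
        _ = p * (β - γ * R) * (1 - p * R) * (δ * p * R) +
              p * (β - γ * R) * (1 - p * R) * p * (ε - δ * R) := by rw [e1]; noncomm_ring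
        _ = _ := by rw [e2]; noncomm_ring
    have e4 : (p * ((β - γ * R) * (p * R * δ))).trace =
        -((p * (β - γ * R) * p) * (p * (ε - δ * R) * p)).trace := by
      calc (p * ((β - γ * R) * (p * R * δ))).trace
          = (p * (p * ((β - γ * R) * (p * R * δ)))).trace := by rw [← mul_assoc p p, hp]
        _ = ((p * (β - γ * R)) * p * R * δ * p).trace := by
            rw [Matrix.trace_mul_comm]; simp only [mul_assoc]
        _ = ((p * (β - γ * R)) * (p * p) * R * δ * p).trace := by rw [hp]
        _ = ((p * (β - γ * R) * p) * (p * R * δ * p)).trace := by simp only [mul_assoc]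
        _ = _ := by rw [ha', mul_neg, Matrix.trace_neg]
    rw [e3, Matrix.trace_sub, T, T, e4, sub_neg_eq_add]
  rw [mul_sub, Matrix.trace_sub, key _ _ _ _ hβ hε, key _ _ _ _ hε hβ,
    Matrix.trace_mul_comm (p * (ε - δ * R) * p), mul_sub p ((β - γ * R) * δ),
    Matrix.trace_sub]
  ring

/-- Cyclicity of the trace, for commutators. -/
theorem trace_mul_commutator (a b c : Matrix (Fin n) (Fin n) ℂ) :
    (a * (b * c - c * b)).trace = (b * (c * a - a * c)).trace := by
  have h1 : (a * (b * c)).trace = (b * (c * a)).trace := by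
    rw [Matrix.trace_mul_comm, mul_assoc]
  have h2 : (a * (c * b)).trace = (b * (a * c)).trace := by
    rw [← mul_assoc, Matrix.trace_mul_comm]
  rw [mul_sub, mul_sub, Matrix.trace_sub, Matrix.trace_sub, h1, h2]

/-- The Jacobi identity, paired with `C` by the trace. -/
theorem trace_jacobi (p C γ δ : Matrix (Fin n) (Fin n) ℂ) :
    ((((γ * p - p * γ) * C - C * (γ * p - p * γ)) * δ).trace -
      (((δ * p - p * δ) * C - C * (δ * p - p * δ)) * γ).trace) =
    ((p * C - C * p) * (δ * γ - γ * δ)).trace := by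
  have e : ∀ a b c d : Matrix (Fin n) (Fin n) ℂ, (a * b * c * d).trace = (b * c * d * a).trace :=
    fun a b c d => by rw [mul_assoc, mul_assoc, Matrix.trace_mul_comm, mul_assoc b c d]
  simp only [mul_sub, sub_mul, Matrix.trace_sub, ← mul_assoc]
  linear_combination e γ p C δ - e δ p C γ - e p γ C δ - e γ C δ p + e p δ C γ + e δ C γ p

end Trace

variable {n : ℕ}

/-! ### Systems of orthogonal projectors and their frames -/

theorem sum_q : ∑ i, (q i : Matrix (Fin n) (Fin n) ℂ) = 1 := by
  ext a b
  rw [Matrix.sum_apply, Finset.sum_eq_single a (fun i _ hi => by simp [q, hi])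
    (fun h => absurd (Finset.mem_univ a) h)]
  simp [q, Matrix.single_apply, Matrix.one_apply]

theorem mul_q_apply (h : Matrix (Fin n) (Fin n) ℂ) (i a b : Fin n) :
    (h * q i) a b = if b = i then h a i else 0 := by
  by_cases hb : b = i
  · subst hb; simp [q]
  · simp [q, hb]

theorem q_mul_apply (h : Matrix (Fin n) (Fin n) ℂ) (i a b : Fin n) :
    (q i * h) a b = if a = i then h i b else 0 := by
  by_cases hb : a = i
  · subst hb; simp [q]
  · simp [q, hb]

/-- A frame of common eigenvectors, one vector in the image of each projector. -/
theorem exists_frame {p : MatTuple n} (hp : p ∈ orthogonalSystems n) :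
    ∃ g : Matrix (Fin n) (Fin n) ℂ, g.det ≠ 0 ∧ ∀ i, p i * g = g * q i := by
  have hne : ∀ i, ∃ w, (p i).mulVec w ≠ 0 := by
    intro i
    by_contra! h
    have h0 : p i = 0 := Matrix.ext_of_mulVec_single fun j => by rw [h, Matrix.zero_mulVec]
    have := (hp.1 i).2
    rw [h0, Matrix.rank_zero] at this
    exact zero_ne_one this
  choose w hw using hne
  let g : Matrix (Fin n) (Fin n) ℂ := Matrix.of fun a j => (p j).mulVec (w j) a
  have hg : ∀ i, p i * g = g * q i := by
    intro i
    ext a j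
    have e : (p i * g) a j = (p i).mulVec ((p j).mulVec (w j)) a := rfl
    rw [e, mul_q_apply, Matrix.mulVec_mulVec]
    split_ifs with h
    · subst h; rw [(hp.1 j).1]; rfl
    · rw [hp.2 i j (Ne.symm h), Matrix.zero_mulVec]; rfl
  refine ⟨g, fun hdet => ?_, hg⟩
  obtain ⟨c, hc, hgc⟩ := Matrix.exists_mulVec_eq_zero_iff.mpr hdet
  apply hc
  funext i
  have h1 : (g * q i).mulVec c = 0 := by
    rw [← hg, ← Matrix.mulVec_mulVec, hgc, Matrix.mulVec_zero]
  have h2 : (g * q i).mulVec c = c i • (p i).mulVec (w i) := by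
    funext a
    simp only [Matrix.mulVec, dotProduct, mul_q_apply, Pi.smul_apply, smul_eq_mul]
    simp [g, Matrix.mulVec, dotProduct, mul_comm]
  rw [h2, smul_eq_zero] at h1
  exact h1.resolve_right (hw i)

theorem sum_eq_one_of_mem {p : MatTuple n} (hp : p ∈ orthogonalSystems n) : ∑ i, p i = 1 := by
  obtain ⟨g, hg, hpg⟩ := exists_frame hp
  have h : (∑ i, p i) * g = g := by
    rw [Finset.sum_mul, Finset.sum_congr rfl fun i _ => hpg i, ← Finset.mul_sum, sum_q, mul_one]
  have hu : IsUnit g := (Matrix.isUnit_iff_isUnit_det g).mpr (isUnit_iff_ne_zero.mpr hg)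
  exact hu.mul_right_cancel (h.trans (one_mul g).symm)

/-- Two rank one projectors `r`, `p` with `im p ⊆ im r` have the same image. -/
theorem IsRankOneProjector.mul_eq_of_mul_eq {r p : Matrix (Fin n) (Fin n) ℂ}
    (hr : IsRankOneProjector r) (hp : IsRankOneProjector p) (h : r * p = p) : p * r = r := by
  have hle : LinearMap.range p.mulVecLin ≤ LinearMap.range r.mulVecLin := by
    rintro _ ⟨w, rfl⟩
    exact ⟨p.mulVec w, by simp [Matrix.mulVec_mulVec, h]⟩
  have heq := Submodule.eq_of_le_of_finrank_eq hle (hp.2.trans hr.2.symm)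
  refine Matrix.ext_of_mulVec_single fun j => ?_
  have hj : r.mulVecLin (Pi.single j 1) ∈ LinearMap.range p.mulVecLin := heq ▸ ⟨_, rfl⟩
  obtain ⟨w, hw⟩ := hj
  simp only [Matrix.mulVecLin_apply] at hw
  rw [← Matrix.mulVec_mulVec, ← hw, Matrix.mulVec_mulVec, hp.1]

/-! ### Differential calculus of orthogonal systems -/

section Differentials

variable {M : SpaceWithFunctions} (p : Fin n → M.MatrixFunction n) {x : M}

/-- Infinitesimal deformations of an orthogonal system are infinitesimal conjugations. -/
theorem exists_generator (hp : ∀ y, (fun i => (p i).1 y) ∈ orthogonalSystems n)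
    (u : M.tangentSpace x) :
    ∃ γ, ∀ i, (p i).d x u = γ * (p i).1 x - (p i).1 x * γ := by
  have h1 : ∀ i, (p i).d x u * (p i).1 x + (p i).1 x * (p i).d x u = (p i).d x u := fun i => by
    rw [← MatrixFunction.d_mul]
    exact MatrixFunction.d_congr u fun y => ((hp y).1 i).1
  have h2 : ∀ i j, i ≠ j → (p i).d x u * (p j).1 x + (p i).1 x * (p j).d x u = 0 :=
    fun i j hij => by
      rw [← MatrixFunction.d_mul, ← MatrixFunction.d_const (M := M) u 0]
      exact MatrixFunction.d_congr u fun y => (hp y).2 i j hij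
  have hsq : ∀ i, (p i).1 x * (p i).1 x = (p i).1 x := fun i => ((hp x).1 i).1
  have hsum : ∑ i, (p i).1 x = 1 := sum_eq_one_of_mem (hp x)
  -- In terms of a frame `g` with `p_i g = g q_i` whose variation `dg` is chosen such that
  -- `p_i dg q_i = 0`, this is `dg g⁻¹`.
  refine ⟨∑ j, (p j).d x u * (p j).1 x, fun i => ?_⟩
  have e1 : (∑ j, (p j).d x u * (p j).1 x) * (p i).1 x = (p i).d x u * (p i).1 x := by
    rw [Finset.sum_mul, Finset.sum_eq_single i]
    · rw [mul_assoc, hsq]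
    · intro j _ hji
      rw [mul_assoc, show (p j).1 x * (p i).1 x = 0 from (hp x).2 j i hji, mul_zero]
    · simp
  have e2 : ∀ j, (p i).1 x * ((p j).d x u * (p j).1 x) =
      -((p i).d x u * (p j).1 x) + if j = i then (p i).d x u * (p i).1 x else 0 := by
    intro j
    split_ifs with hj
    · subst hj
      have h := congrArg (fun m => (p j).1 x * m * (p j).1 x) (h1 j)
      simp only [mul_add, add_mul, mul_assoc, hsq] at h
      simp only [← mul_assoc, hsq] at h ⊢
      rw [neg_add_cancel]
      exact left_eq_add.mp h.symm
    · rw [add_zero, ← mul_assoc, ← eq_neg_of_add_eq_zero_right (h2 i j (Ne.symm hj)) |>.symm,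
        neg_mul, mul_assoc, hsq]
  have e3 : (p i).1 x * ∑ j, (p j).d x u * (p j).1 x =
      -(p i).d x u + (p i).d x u * (p i).1 x := by
    rw [Finset.mul_sum, Finset.sum_congr rfl fun j _ => e2 j, Finset.sum_add_distrib,
      Finset.sum_neg_distrib, ← Finset.mul_sum, hsum, mul_one]
    simp
  rw [e1, e3]
  abel

/-- If `p_i g = g q_i`, then `dg g⁻¹` generates the deformation of the `p_i`. -/
theorem d_eq_of_frame {i : Fin n} (P g : M.MatrixFunction n) (hg : (g.1 x).det ≠ 0)
    (h : ∀ y, P.1 y * g.1 y = g.1 y * q i) (u : M.tangentSpace x) :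
    P.d x u = g.d x u * (g.1 x)⁻¹ * P.1 x - P.1 x * (g.d x u * (g.1 x)⁻¹) := by
  have h1 : P.d x u * g.1 x + P.1 x * g.d x u = g.d x u * q i := by
    have e := MatrixFunction.d_congr (F := P.mul g) (H := g.mul (.const M (q i))) u h
    rw [MatrixFunction.d_mul, MatrixFunction.d_mul, MatrixFunction.d_const, mul_zero,
      add_zero] at e
    exact e
  have hu := isUnit_iff_ne_zero.mpr hg
  have h2 : (g.1 x)⁻¹ * P.1 x = q i * (g.1 x)⁻¹ := by
    calc (g.1 x)⁻¹ * P.1 x = (g.1 x)⁻¹ * (P.1 x * g.1 x) * (g.1 x)⁻¹ := by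
          rw [← mul_assoc, Matrix.mul_nonsing_inv_cancel_right _ _ hu]
      _ = _ := by rw [h, Matrix.nonsing_inv_mul_cancel_left _ _ hu]
  calc P.d x u = (P.d x u * g.1 x) * (g.1 x)⁻¹ := by
        rw [Matrix.mul_nonsing_inv_cancel_right _ _ hu]
    _ = _ := by
        rw [eq_sub_of_add_eq h1, sub_mul, mul_assoc (g.d x u) (q i), ← h2]
        simp only [mul_assoc]

/-- The form `∑ Tr r_i dr_i ∧ dr_i` for `r_i = p_i R`, in terms of `dR` and generators of the
deformations of the orthogonal system `p`. -/
theorem sum_trace_projector_form (R : M.MatrixFunction n)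
    (hp : ∀ y, (fun i => (p i).1 y) ∈ orthogonalSystems n)
    (hR : ∀ i y, (p i).1 y * R.1 y * (p i).1 y = (p i).1 y) {u v : M.tangentSpace x}
    {γ δ : Matrix (Fin n) (Fin n) ℂ} (hγ : ∀ i, (p i).d x u = γ * (p i).1 x - (p i).1 x * γ)
    (hδ : ∀ i, (p i).d x v = δ * (p i).1 x - (p i).1 x * δ) :
    ∑ i, (((p i).mul R).1 x * (((p i).mul R).d x u * ((p i).mul R).d x v -
      ((p i).mul R).d x v * ((p i).mul R).d x u)).trace =
    (R.d x u * δ).trace - (R.d x v * γ).trace - (R.1 x * (δ * γ - γ * δ)).trace := by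
  have hsq : ∀ i, (p i).1 x * (p i).1 x = (p i).1 x := fun i => ((hp x).1 i).1
  -- The differential of `p_i R p_i = p_i`, compressed by `p_i`.
  have hβ : ∀ (w : M.tangentSpace x) (γ : Matrix (Fin n) (Fin n) ℂ),
      (∀ i, (p i).d x w = γ * (p i).1 x - (p i).1 x * γ) →
      ∀ i, (p i).1 x * R.d x w * (p i).1 x = (p i).1 x * (γ * R.1 x - R.1 x * γ) * (p i).1 x := by
    intro w γ hγ i
    have e := MatrixFunction.d_congr (F := ((p i).mul R).mul (p i)) (H := p i) w (hR i)
    have e2 : ((p i).d x w * R.1 x + (p i).1 x * R.d x w) * (p i).1 x +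
        (p i).1 x * R.1 x * (p i).d x w = (p i).d x w := by
      rw [MatrixFunction.d_mul, MatrixFunction.d_mul] at e
      exact e
    rw [hγ] at e2
    have hRx := hR i x
    have hi := hsq i
    generalize (p i).1 x = P at *
    generalize R.d x w = β at *
    generalize R.1 x = T at *
    have e3 : P * P * β * (P * P) = P * (γ * P - P * γ) * P -
        P * (γ * P - P * γ) * T * (P * P) - (P * P) * T * (γ * P - P * γ) * P := by
      rw [← congrArg (fun m => P * m * P) e2]
      noncomm_ring
    rw [hi] at e3
    rw [e3]
    calc P * (γ * P - P * γ) * P - P * (γ * P - P * γ) * T * P - P * T * (γ * P - P * γ) * P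
        = P * γ * (P * P) - (P * P) * γ * P - P * γ * (P * T * P) + (P * P) * γ * T * P -
            P * T * γ * (P * P) + (P * T * P) * γ * P := by noncomm_ring
      _ = _ := by rw [hi, hRx]; noncomm_ring
  have e : ∀ i, (((p i).mul R).1 x * (((p i).mul R).d x u * ((p i).mul R).d x v -
      ((p i).mul R).d x v * ((p i).mul R).d x u)).trace =
      ((p i).1 x * ((R.d x u - γ * R.1 x) * δ - (R.d x v - δ * R.1 x) * γ)).trace := by
    intro i
    rw [← trace_projector_form (hsq i) (hR i x) (hβ u γ hγ i) (hβ v δ hδ i),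
      MatrixFunction.d_mul, MatrixFunction.d_mul, hγ, hδ]
    rfl
  rw [Finset.sum_congr rfl fun i _ => e i, ← Matrix.trace_sum, ← Finset.sum_mul,
    show ∑ i, (p i).1 x = 1 from sum_eq_one_of_mem (hp x), one_mul]
  have c1 : (γ * R.1 x * δ).trace = (R.1 x * (δ * γ)).trace := by
    rw [mul_assoc, Matrix.trace_mul_comm, mul_assoc]
  have c2 : (δ * R.1 x * γ).trace = (R.1 x * (γ * δ)).trace := by
    rw [mul_assoc, Matrix.trace_mul_comm, mul_assoc]
  simp only [sub_mul, mul_sub, Matrix.trace_sub, c1, c2]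
  ring

end Differentials

/-! ### The open embedding of the reduction -/

theorem pOf_mul_g (i : Fin n) (z : Z n) : pOf i z * z.1.1 = z.1.1 * q i := by
  rw [pOf, mul_assoc, inv_mul_Z, mul_one]

theorem eq_pOf {i : Fin n} {z : Z n} {p : Matrix (Fin n) (Fin n) ℂ}
    (h : p * z.1.1 = z.1.1 * q i) : p = pOf i z := by
  rw [pOf, ← h, mul_assoc, mul_inv_Z, mul_one]

theorem pOf_mul_pOf (i : Fin n) (z : Z n) : pOf i z * pOf i z = pOf i z :=
  ((pOf_mem z).1 i).1

/-- The moment map equation `diag (A g) = 0`, in terms of `p_i` and `g A`. -/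
theorem pOf_mul_mul_pOf (i : Fin n) (z : Z n) : pOf i z * (z.1.1 * z.1.2) * pOf i z = 0 := by
  calc pOf i z * (z.1.1 * z.1.2) * pOf i z
      = (pOf i z * z.1.1) * z.1.2 * pOf i z := by simp only [mul_assoc]
    _ = z.1.1 * (q i * (z.1.2 * z.1.1) * q i) * z.1.1⁻¹ := by
        rw [pOf_mul_g, pOf]; simp only [mul_assoc]
    _ = 0 := by rw [q_mul_mul_q i _ z.2.2, mul_zero, zero_mul]

theorem rOf_mul_g_mul_q (i : Fin n) (z : Z n) : rOf i z * z.1.1 * q i = z.1.1 * q i := by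
  calc rOf i z * z.1.1 * q i
      = pOf i z * z.1.1 * q i + (pOf i z * z.1.1) * z.1.2 * z.1.1 * q i := by
        simp only [rOf, pOf]; noncomm_ring
    _ = z.1.1 * (q i * q i) + z.1.1 * (q i * (z.1.2 * z.1.1) * q i) := by
        rw [pOf_mul_g]; simp only [mul_assoc]
    _ = _ := by rw [q_mul_mul_q i _ z.2.2, q_mul_self, mul_zero, add_zero]

theorem q_mul_inv_mul_rOf (i : Fin n) (z : Z n) :
    q i * z.1.1⁻¹ * rOf i z = q i * (z.1.1⁻¹ + z.1.2) := by
  calc q i * z.1.1⁻¹ * rOf i z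
      = q i * (z.1.1⁻¹ * z.1.1) * q i * (z.1.1⁻¹ + z.1.1⁻¹ * z.1.1 * z.1.2) := by
        rw [rOf]; noncomm_ring
    _ = _ := by rw [inv_mul_Z, mul_one, one_mul, q_mul_self]

/-- The matrix `A` is determined by `g` and the `r_i`. -/
theorem sum_q_mul_inv_mul_rOf (z : Z n) :
    ∑ i, q i * z.1.1⁻¹ * rOf i z - z.1.1⁻¹ = z.1.2 := by
  rw [Finset.sum_congr rfl fun i _ => q_mul_inv_mul_rOf i z, ← Finset.sum_mul, sum_q, one_mul,
    add_sub_cancel_left]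

/-- The fibres of `(g, A) ↦ (r_i)` are torus orbits. -/
theorem exists_smul_eq_of_rOf_eq {z w : Z n} (h : ∀ i, rOf i z = rOf i w) :
    ∃ t : Torus n, t • w = z := by
  -- `g q_i` and `g' q_i` span the image of `r_i`, so that `g'⁻¹ g` is a diagonal matrix.
  have hz : IsUnit z.1.1.det := isUnit_iff_ne_zero.mpr z.2.1
  have hw : IsUnit w.1.1.det := isUnit_iff_ne_zero.mpr w.2.1
  have h1 : ∀ i, w.1.1⁻¹ * z.1.1 * q i =
      q i * (w.1.1⁻¹ * (1 + w.1.1 * w.1.2) * (z.1.1 * q i)) := fun i => by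
    calc w.1.1⁻¹ * z.1.1 * q i = w.1.1⁻¹ * (rOf i w * z.1.1 * q i) := by
          rw [← h, rOf_mul_g_mul_q, mul_assoc]
      _ = (w.1.1⁻¹ * w.1.1) * q i * w.1.1⁻¹ * (1 + w.1.1 * w.1.2) * z.1.1 * q i := by
          rw [rOf]; simp only [mul_assoc]
      _ = _ := by rw [inv_mul_Z, one_mul]; simp only [mul_assoc]
  have hoff : ∀ a i, a ≠ i → (w.1.1⁻¹ * z.1.1) a i = 0 := fun a i hai => by
    have := congrFun (congrFun (h1 i) a) i
    rwa [mul_q_apply, q_mul_apply, if_pos rfl, if_neg hai] at this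
  have hdiag : w.1.1⁻¹ * z.1.1 = Matrix.diagonal fun i => (w.1.1⁻¹ * z.1.1) i i := by
    ext a i
    by_cases hai : a = i
    · subst hai; simp
    · rw [hoff a i hai, Matrix.diagonal_apply_ne _ hai]
  have hdet : ∏ i, (w.1.1⁻¹ * z.1.1) i i ≠ 0 := by
    rw [← Matrix.det_diagonal, ← hdiag, Matrix.det_mul]
    exact mul_ne_zero (Matrix.isUnit_nonsing_inv_det _ hw).ne_zero hz.ne_zero
  have hne : ∀ i, (w.1.1⁻¹ * z.1.1) i i ≠ 0 := fun i =>
    Finset.prod_ne_zero_iff.mp hdet i (Finset.mem_univ i)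
  let t : Torus n := fun i => (Units.mk0 _ (hne i))⁻¹
  have ht : Torus.diag t⁻¹ = w.1.1⁻¹ * z.1.1 := by
    rw [hdiag]
    simp [t, Torus.diag]
  have hg : (t • w).1.1 = z.1.1 := by
    change w.1.1 * Torus.diag t⁻¹ = z.1.1
    rw [ht, Matrix.mul_nonsing_inv_cancel_left _ _ hw]
  refine ⟨t, Subtype.ext (Prod.ext hg ?_)⟩
  rw [← sum_q_mul_inv_mul_rOf z, ← sum_q_mul_inv_mul_rOf (t • w), hg]
  simp only [rOf_smul, h]

theorem phi_injective : Function.Injective (phi n) := by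
  intro a b
  induction a using Quotient.inductionOn with | h z => ?_
  induction b using Quotient.inductionOn with | h w => ?_
  intro h
  have h' : phiLevel n z = phiLevel n w := h
  exact Quotient.sound (exists_smul_eq_of_rOf_eq fun i => congrFun (congrArg Subtype.val h') i)

/-- The matrix `g` whose columns lie in the images of the `r_i`, and which is `g₀` if the columns
of `g₀` already do so. -/
def frameOf (g₀ : Matrix (Fin n) (Fin n) ℂ) (r : MatTuple n) : Matrix (Fin n) (Fin n) ℂ :=
  ∑ i, r i * (g₀ * q i)

/-- The solution `A` of `r_i = g q_i g⁻¹ (1 + g A)`, for `g = frameOf g₀ r`. -/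
noncomputable def momentumOf (g₀ : Matrix (Fin n) (Fin n) ℂ) (r : MatTuple n) :
    Matrix (Fin n) (Fin n) ℂ :=
  ∑ i, q i * (frameOf g₀ r)⁻¹ * r i + -1 * (frameOf g₀ r)⁻¹

theorem frameOf_mul_q (g₀ : Matrix (Fin n) (Fin n) ℂ) (r : MatTuple n) (i : Fin n) :
    frameOf g₀ r * q i = r i * (g₀ * q i) := by
  rw [frameOf, Finset.sum_mul, Finset.sum_eq_single i]
  · rw [mul_assoc, mul_assoc, q_mul_self]
  · intro j _ hji
    rw [mul_assoc, mul_assoc, q_mul_q hji, mul_zero, mul_zero]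
  · simp

theorem mul_frameOf_mul_q (g₀ : Matrix (Fin n) (Fin n) ℂ) {r : MatTuple n}
    (hr : r ∈ projectorTuples n) (i : Fin n) :
    r i * (frameOf g₀ r * q i) = frameOf g₀ r * q i := by
  rw [frameOf_mul_q, ← mul_assoc, (hr i).1]

theorem momentumOf_mul_frameOf (g₀ : Matrix (Fin n) (Fin n) ℂ) {r : MatTuple n}
    (hr : r ∈ projectorTuples n) : (momentumOf g₀ r * frameOf g₀ r).diag = 0 := by
  have h0 : ∀ i, q i * (momentumOf g₀ r * frameOf g₀ r) * q i = 0 := by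
    intro i
    have e : q i * momentumOf g₀ r = q i * (frameOf g₀ r)⁻¹ * r i - q i * (frameOf g₀ r)⁻¹ := by
      rw [momentumOf, mul_add, Finset.mul_sum, Finset.sum_eq_single i]
      · rw [← mul_assoc, ← mul_assoc, q_mul_self]; noncomm_ring
      · intro j _ hji
        rw [← mul_assoc, ← mul_assoc, q_mul_q (Ne.symm hji), zero_mul, zero_mul]
      · simp
    calc q i * (momentumOf g₀ r * frameOf g₀ r) * q i
        = (q i * momentumOf g₀ r) * (frameOf g₀ r * q i) := by simp only [mul_assoc]
      _ = q i * (frameOf g₀ r)⁻¹ * (r i * (frameOf g₀ r * q i)) -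
            q i * (frameOf g₀ r)⁻¹ * (frameOf g₀ r * q i) := by rw [e]; noncomm_ring
      _ = 0 := by rw [mul_frameOf_mul_q g₀ hr, sub_self]
  funext i
  have := congrFun (congrFun (h0 i) i) i
  rwa [mul_q_apply, q_mul_apply, if_pos rfl, if_pos rfl] at this

/-- The local section of `μ_T⁻¹(0) → Y` through `z₀ = (g₀, A₀)`; it takes the junk value `z₀` where
`frameOf g₀ r` is not invertible. -/
noncomputable def levelSection (z₀ : Z n) (r : Y n) : Z n :=
  open scoped Classical in
  if h : (frameOf z₀.1.1 r.1).det ≠ 0 then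
    ⟨(frameOf z₀.1.1 r.1, momentumOf z₀.1.1 r.1), h, momentumOf_mul_frameOf _ r.2⟩
  else z₀

theorem levelSection_val {z₀ : Z n} {r : Y n} (h : (frameOf z₀.1.1 r.1).det ≠ 0) :
    (levelSection z₀ r).1 = (frameOf z₀.1.1 r.1, momentumOf z₀.1.1 r.1) :=
  congrArg Subtype.val (dif_pos h)

theorem frameOf_phiLevel (z : Z n) : frameOf z.1.1 (phiLevel n z).1 = z.1.1 := by
  change ∑ i, rOf i z * (z.1.1 * q i) = z.1.1
  rw [Finset.sum_congr rfl fun i _ => (mul_assoc _ _ _).symm.trans (rOf_mul_g_mul_q i z),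
    ← Finset.mul_sum, sum_q, mul_one]

theorem levelSection_phiLevel (z : Z n) : levelSection z (phiLevel n z) = z := by
  have hg := frameOf_phiLevel z
  have h : (frameOf z.1.1 (phiLevel n z).1).det ≠ 0 := by rw [hg]; exact z.2.1
  refine Subtype.ext ((levelSection_val h).trans (Prod.ext hg ?_))
  change momentumOf z.1.1 (phiLevel n z).1 = z.1.2
  rw [momentumOf, hg, ← sum_q_mul_inv_mul_rOf z, neg_one_mul, sub_eq_add_neg]
  rfl

theorem phiLevel_levelSection (z₀ : Z n) (r : Y n) (h : (frameOf z₀.1.1 r.1).det ≠ 0) :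
    phiLevel n (levelSection z₀ r) = r := by
  apply Subtype.ext
  funext i
  change rOf i (levelSection z₀ r) = r.1 i
  have hz := levelSection_val h
  generalize levelSection z₀ r = z at hz
  have hg : z.1.1 = frameOf z₀.1.1 r.1 := congrArg Prod.fst hz
  have hA : z.1.2 = momentumOf z₀.1.1 r.1 := congrArg Prod.snd hz
  have hr : ∀ j, r.1 j * (z.1.1 * q j) = z.1.1 * q j := fun j => by
    rw [hg]; exact mul_frameOf_mul_q _ r.2 j
  have h1 : z.1.1⁻¹ + z.1.2 = ∑ j, q j * z.1.1⁻¹ * r.1 j := by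
    rw [hA, momentumOf, ← hg]; noncomm_ring
  have hp : IsRankOneProjector (pOf i z) := (pOf_mem z).1 i
  -- `p_i` and `r_i` are projectors of rank one with the same image, the line of the `i`-th column.
  have hrp : r.1 i * pOf i z = pOf i z := by
    rw [pOf, ← mul_assoc, hr]
  calc rOf i z = z.1.1 * q i * (z.1.1⁻¹ + z.1.1⁻¹ * z.1.1 * z.1.2) := by
        rw [rOf]; noncomm_ring
    _ = z.1.1 * (q i * ∑ j, q j * z.1.1⁻¹ * r.1 j) := by rw [inv_mul_Z, one_mul, h1, mul_assoc]
    _ = pOf i z * r.1 i := by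
        rw [Finset.mul_sum, Finset.sum_eq_single i]
        · rw [← mul_assoc (q i), ← mul_assoc (q i), q_mul_self, pOf]; simp only [mul_assoc]
        · intro j _ hji
          rw [← mul_assoc, ← mul_assoc, q_mul_q (Ne.symm hji), zero_mul, zero_mul]
        · simp
    _ = r.1 i := (r.2 i).mul_eq_of_mul_eq hp hrp

theorem isLocalSectionAt_levelSection (z : Z n) :
    IsLocalSectionAt (phiLevel n) (levelSection z) (phiLevel n z) := by
  let G : (Y n).MatrixFunction n :=
    .sum fun i => (Y.r i).mul (.const (Y n) (z.1.1 * q i))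
  have hG : ∀ r : Y n, G.1 r = frameOf z.1.1 r.1 := fun r => rfl
  have hdet : (G.1 (phiLevel n z)).det ≠ 0 := by rw [hG, frameOf_phiLevel]; exact z.2.1
  obtain ⟨W, hW, hzW, hne⟩ := (Y n).regAt_ne (G.regAt_det (phiLevel n z)) hdet
  refine ⟨isRegularMapAt_affine (S := zeroLevel n) _ _ fun l => ?_, W, hW, hzW,
    fun r hr => phiLevel_levelSection z r (hne r hr)⟩
  have hinv := MatrixFunction.regAt_nonsing_inv (fun a b => G.2 (phiLevel n z) a b) hdet
  have hA : ∀ a b, (Y n).RegAt (fun r => momentumOf z.1.1 r.1 a b) (phiLevel n z) := by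
    intro a b
    refine (Y n).regAt_add (f := fun r => (∑ i, q i * (G.1 r)⁻¹ * r.1 i) a b)
      (g := fun r => (-1 * (G.1 r)⁻¹) a b) ?_ ?_
    · simp only [Matrix.sum_apply]
      refine MatrixFunction.regAt_sum _ (fun i r => (q i * (G.1 r)⁻¹ * r.1 i) a b) _ fun i _ => ?_
      exact MatrixFunction.regAt_matrix_mul (MatrixFunction.regAt_matrix_mul
        ((MatrixFunction.const (Y n) (q i)).2 _) hinv) ((Y.r i).2 _) a b
    · exact MatrixFunction.regAt_matrix_mul ((MatrixFunction.const (Y n) (-1)).2 _) hinv a b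
  refine (Y n).regAt_congr hW hzW (fun r hr => ?_) ((Y n).regAt_add
    (MatrixFunction.regAt_matrix_functional (fun a b => G.2 (phiLevel n z) a b)
      (l.comp (LinearMap.inl ℂ _ _)))
    (MatrixFunction.regAt_matrix_functional hA (l.comp (LinearMap.inr ℂ _ _))))
  rw [levelSection_val (hne r hr)]
  simp only [LinearMap.comp_apply, ← map_add, LinearMap.inl_apply, LinearMap.inr_apply,
    Prod.mk_add_mk, add_zero, zero_add]
  rfl

theorem isOpenEmbedding_phi : (phi n).IsOpenEmbedding := by
  refine RegularMap.isOpenEmbedding_of_localSections _ phi_injective fun x => ?_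
  induction x using Quotient.inductionOn with | h z => ?_
  obtain ⟨h, W, hW, hzW, hsec⟩ := isLocalSectionAt_levelSection z
  exact ⟨fun r => reductionMap n (levelSection z r),
    ⟨((reductionMap n).isRegularMapAt _).comp h, W, hW, hzW, hsec⟩,
    congrArg (reductionMap n) (levelSection_phiLevel z)⟩

/-! ### Covectors of the variety of orthogonal systems -/

/-- The tangent space of a subvariety of a finite-dimensional vector space embeds into this vector
space. -/
theorem exists_velocity {V : Type} [AddCommGroup V] [Module ℂ V] [FiniteDimensional ℂ V] {S : Set V}
    {x : S} (D : (affine S).tangentSpace x) :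
    ∃ v : V, ∀ l : V →ₗ[ℂ] ℂ, D.1 ⟨fun y : S => l y, regAt_affine_linear l x⟩ = l v := by
  let E : Module.Dual ℂ (Module.Dual ℂ V) :=
    { toFun := fun l => D.1 ⟨fun y : S => l y, regAt_affine_linear l x⟩
      map_add' := fun l m => D.1.map_add ⟨fun y : S => l y, regAt_affine_linear l x⟩
        ⟨fun y : S => m y, regAt_affine_linear m x⟩
      map_smul' := fun c l => D.1.map_smul c ⟨fun y : S => l y, regAt_affine_linear l x⟩ }
  obtain ⟨v, hv⟩ := (Module.evalEquiv ℂ V).surjective E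
  exact ⟨v, fun l => (LinearMap.congr_fun hv l).symm⟩

/-- The velocity `(dp_i)_i` of a tangent vector of `X`. -/
def velocity (p : X n) : (X n).tangentSpace p →ₗ[ℂ] MatTuple n :=
  LinearMap.pi fun i => (X.p i).d p

theorem velocity_injective (p : X n) : Function.Injective (velocity p) := by
  have key : ∀ (D : (X n).tangentSpace p) (l : MatTuple n →ₗ[ℂ] ℂ),
      D.1 ⟨fun y => l y.1, regAt_affine_linear l p⟩ = l (velocity p D) := by
    intro D l
    obtain ⟨v, hv⟩ := exists_velocity (S := orthogonalSystems n) D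
    have e : velocity p D = v := by
      funext i
      ext a b
      exact hv ((Matrix.entryLinearMap ℂ ℂ a b).comp (LinearMap.proj i))
    rw [e]
    exact hv l
  intro D E h
  exact tangentSpace_affine_ext (S := orthogonalSystems n) fun l =>
    (key D l).trans ((congrArg l h).trans (key E l).symm)

/-- The point `p` of `X` under an ambient covector `(p, C)`. -/
def basePoint (y : ambientForms n) : X n := ⟨y.1.1, y.2.1⟩

theorem restrictForm_snd (y : ambientForms n) (D : (X n).tangentSpace (basePoint y)) :
    (restrictForm n y).2 D = ∑ i, (y.1.2 i * (X.p i).d (basePoint y) D).trace :=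
  LinearMap.sum_apply Finset.univ (fun i => (Matrix.traceLinearMap (Fin n) ℂ ℂ).comp
    ((LinearMap.mulLeft ℂ (y.1.2 i)).comp ((X.p i).d (basePoint y)))) D

/-- All covectors of `X` are restrictions of ambient covectors. -/
theorem restrictForm_surjective : Function.Surjective (restrictForm n) := by
  rintro ⟨p, ξ⟩
  obtain ⟨l, hl⟩ := LinearMap.dualMap_surjective_of_injective (velocity_injective p) ξ
  let C : MatTuple n := fun i => Matrix.of fun a b => l (Pi.single i (Matrix.single b a 1))
  refine ⟨⟨(p.1, C), p.2, trivial⟩, ?_⟩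
  refine Sigma.ext rfl (heq_of_eq (LinearMap.ext fun D => ?_))
  have e : ∀ v : MatTuple n, l v = ∑ i, (C i * v i).trace := by
    intro v
    rw [matTuple_functional l v]
    refine Finset.sum_congr rfl fun i _ => ?_
    rw [Matrix.trace_mul_comm]
    simp only [Matrix.trace, Matrix.diag_apply, Matrix.mul_apply, C, Matrix.of_apply]
  rw [← hl]
  exact (restrictForm_snd ⟨(p.1, C), p.2, trivial⟩ D).trans (e (velocity p D)).symm

/-- The matrix `B = ∑ [p_i, C_i]` of the covector `∑ Tr (C_i dp_i)`: the value of this covector on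
the tangent vector `([γ, p_i])_i` is `Tr (γ B)`. -/
def ambientForms.B : (ambientForms n).MatrixFunction n :=
  .sum fun i => (ambientForms.p i).commutator (ambientForms.C i)

theorem ambientForms.B_val (y : ambientForms n) :
    ambientForms.B.1 y = ∑ i, (y.1.1 i * y.1.2 i - y.1.2 i * y.1.1 i) :=
  Finset.sum_congr (s₁ := Finset.univ)
    (f := fun i => ((ambientForms.p i).commutator (ambientForms.C i)).1 y) rfl fun i _ =>
    MatrixFunction.commutator_val (ambientForms.p i) (ambientForms.C i) y

theorem ambientForms.p_mem (y : ambientForms n) :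
    (fun i => (ambientForms.p i).1 y) ∈ orthogonalSystems n :=
  y.2.1

theorem ambientForms.p_mul_B_mul_p (i : Fin n) (y : ambientForms n) :
    (ambientForms.p i).1 y * ambientForms.B.1 y * (ambientForms.p i).1 y = 0 := by
  have hy : y.1.1 ∈ orthogonalSystems n := y.2.1
  rw [ambientForms.B_val]
  change y.1.1 i * _ * y.1.1 i = 0
  rw [Finset.mul_sum, Finset.sum_mul]
  refine Finset.sum_eq_zero fun j _ => ?_
  have e : y.1.1 i * (y.1.1 j * y.1.2 j - y.1.2 j * y.1.1 j) * y.1.1 i =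
      (y.1.1 i * y.1.1 j) * y.1.2 j * y.1.1 i - y.1.1 i * y.1.2 j * (y.1.1 j * y.1.1 i) := by
    noncomm_ring
  rw [e]
  by_cases hij : i = j
  · subst hij
    rw [(hy.1 i).1, sub_self]
  · rw [hy.2 i j hij, hy.2 j i (Ne.symm hij)]
    simp

theorem restrictForm_apply (y : ambientForms n) (D : (X n).tangentSpace (basePoint y))
    (γ : Matrix (Fin n) (Fin n) ℂ)
    (h : ∀ i, (X.p i).d (basePoint y) D = γ * y.1.1 i - y.1.1 i * γ) :
    (restrictForm n y).2 D = (γ * ambientForms.B.1 y).trace := by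
  rw [ambientForms.B_val, Finset.mul_sum, Matrix.trace_sum]
  refine (restrictForm_snd y D).trans (Finset.sum_congr rfl fun i _ => ?_)
  rw [h, trace_mul_commutator]

/-- All infinitesimal conjugations are tangent vectors of `X`, being the images of the velocities
of the lines `t ↦ (g + t γ g, 0)` in `μ_T⁻¹(0)`. -/
theorem exists_tangentSpace_conjugation (p : X n) (γ : Matrix (Fin n) (Fin n) ℂ) :
    ∃ D : (X n).tangentSpace p, ∀ i, (X.p i).d p D = γ * p.1 i - p.1 i * γ := by
  obtain ⟨g, hg, hpg⟩ := exists_frame p.2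
  let z : Z n := ⟨(g, 0), hg, by simp⟩
  have hz : ∀ i, p.1 i = pOf i z := fun i => eq_pOf (hpg i)
  have hp : baseMap n z = p := Subtype.ext (funext fun i => (hz i).symm)
  have hline : ∀ᶠ t : ℂ in 𝓝 0,
      z.1 + t • (γ * g, (0 : Matrix (Fin n) (Fin n) ℂ)) ∈ zeroLevel n := by
    have hc : Continuous fun t : ℂ => (g + t • (γ * g)).det := by fun_prop
    have h0 : (g + (0 : ℂ) • (γ * g)).det ≠ 0 := by simpa using hg
    filter_upwards [hc.continuousAt.eventually_ne h0] with t ht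
    refine ⟨ht, ?_⟩
    simp [z]
  obtain ⟨u, hu⟩ := exists_tangentSpace_of_line (S := zeroLevel n) z (γ * g, 0) hline
  have hdg : (Z.g).d z u = γ * g := by
    ext a b
    exact hu ((Matrix.entryLinearMap ℂ ℂ a b).comp (LinearMap.fst ℂ _ _))
  rw [← hp]
  refine ⟨(baseMap n).tangentMap z u, fun i => ?_⟩
  have h := d_eq_of_frame (i := i) (x := z) (Z.p i) Z.g z.2.1 (fun w => pOf_mul_g i w) u
  rw [hdg] at h
  have hgg : γ * g * ((Z.g).1 z)⁻¹ = γ :=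
    Matrix.mul_nonsing_inv_cancel_right _ _ (isUnit_iff_ne_zero.mpr hg)
  rw [hgg] at h
  exact h

/-- A covector of `X` amounts to a point `p` and a matrix `B` with `p_i B p_i = 0`. -/
theorem restrictForm_eq_iff (y y' : ambientForms n) :
    restrictForm n y = restrictForm n y' ↔
      y.1.1 = y'.1.1 ∧ ambientForms.B.1 y = ambientForms.B.1 y' := by
  obtain ⟨⟨p, C⟩, hy⟩ := y
  obtain ⟨⟨p', C'⟩, hy'⟩ := y'
  constructor
  · intro h
    have hp : p = p' := congrArg (fun ξ : Covector n => ξ.1.1) h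
    subst hp
    refine ⟨rfl, ?_⟩
    have hξ := eq_of_heq (Sigma.mk.inj h).2
    refine Matrix.ext_iff_trace_mul_left.mpr fun γ => ?_
    obtain ⟨D, hD⟩ := exists_tangentSpace_conjugation ⟨p, hy.1⟩ γ
    have e1 := restrictForm_apply ⟨(p, C), hy⟩ D γ hD
    have e2 := restrictForm_apply ⟨(p, C'), hy'⟩ D γ hD
    exact e1.symm.trans ((LinearMap.congr_fun hξ D).trans e2)
  · rintro ⟨hp, hB⟩
    change p = p' at hp
    subst hp
    refine Sigma.ext rfl (heq_of_eq (LinearMap.ext fun D => ?_))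
    obtain ⟨γ, hγ⟩ := exists_generator (fun i => X.p i) (fun w : X n => w.2) D
    have e1 := restrictForm_apply ⟨(p, C), hy⟩ D γ hγ
    have e2 := restrictForm_apply ⟨(p, C'), hy'⟩ D γ hγ
    rw [hB] at e1
    exact e1.trans e2.symm

/-! ### The identification of the reduction with the cotangent bundle -/

/-- The morphism `(g, A) ↦ ((p_i), (-g A p_i))`. The covector `∑ Tr (C_i dp_i)` for
`C_i = - g A p_i` pulls back to `Tr (A dg)`. -/
noncomputable def levelToForms (n : ℕ) : RegularMap (Z n) (ambientForms n) :=
  RegularMap.mkAffine (S := orthogonalSystems n ×ˢ Set.univ)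
    (fun z => ⟨(fun i => pOf i z, fun i => -1 * (z.1.1 * z.1.2) * pOf i z), pOf_mem z, trivial⟩)
    fun l x => by
      have h := (Z n).regAt_add
        (regAt_functional (fun i => Z.p i) (l.comp (LinearMap.inl ℂ _ _)) x)
        (regAt_functional (fun i => ((MatrixFunction.const _ (-1)).mul (Z.g.mul Z.A)).mul (Z.p i))
          (l.comp (LinearMap.inr ℂ _ _)) x)
      simp only [LinearMap.comp_apply, ← map_add, LinearMap.inl_apply, LinearMap.inr_apply,
        Prod.mk_add_mk, add_zero, zero_add] at h
      exact h

theorem B_levelToForms (z : Z n) : ambientForms.B.1 (levelToForms n z) = z.1.1 * z.1.2 := by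
  have e : ∀ i, pOf i z * (-1 * (z.1.1 * z.1.2) * pOf i z) -
      -1 * (z.1.1 * z.1.2) * pOf i z * pOf i z = (z.1.1 * z.1.2) * pOf i z := by
    intro i
    calc pOf i z * (-1 * (z.1.1 * z.1.2) * pOf i z) - -1 * (z.1.1 * z.1.2) * pOf i z * pOf i z
        = -(pOf i z * (z.1.1 * z.1.2) * pOf i z) + (z.1.1 * z.1.2) * (pOf i z * pOf i z) := by
          noncomm_ring
      _ = _ := by rw [pOf_mul_mul_pOf, pOf_mul_pOf, neg_zero, zero_add]
  rw [ambientForms.B_val]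
  refine (Finset.sum_congr rfl fun i _ => e i).trans ?_
  rw [← Finset.mul_sum, sum_eq_one_of_mem (pOf_mem z), mul_one]

theorem pOf_smul (i : Fin n) (t : Torus n) (z : Z n) : pOf i (t • z) = pOf i z := by
  refine (eq_pOf (z := t • z) ?_).symm
  change pOf i z * (z.1.1 * Torus.diag t⁻¹) = z.1.1 * Torus.diag t⁻¹ * q i
  have h : Torus.diag t⁻¹ * q i = q i * Torus.diag t⁻¹ := by
    ext a b
    simp only [Torus.diag, Matrix.diagonal_mul, Matrix.mul_diagonal, q, Matrix.single_apply]
    split_ifs with h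
    · obtain ⟨rfl, rfl⟩ := h; ring
    · simp
  rw [← mul_assoc, pOf_mul_g, mul_assoc, mul_assoc, h]

theorem levelToForms_smul (t : Torus n) (z : Z n) :
    levelToForms n (t • z) = levelToForms n z := by
  have h : (t • z).1.1 * (t • z).1.2 = z.1.1 * z.1.2 := by
    change z.1.1 * Torus.diag t⁻¹ * (Torus.diag t * z.1.2) = _
    rw [mul_assoc, ← mul_assoc (Torus.diag t⁻¹), Torus.diag_inv_mul, one_mul]
  refine Subtype.ext (Prod.ext (funext fun i => pOf_smul i t z) (funext fun i => ?_))
  change -1 * ((t • z).1.1 * (t • z).1.2) * pOf i (t • z) = -1 * (z.1.1 * z.1.2) * pOf i z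
  rw [h, pOf_smul]

/-- The morphism `μ_T⁻¹(0)/T → Ω¹X`. -/
noncomputable def reductionToCotangent (n : ℕ) : RegularMap (reduction n) (cotangentBundle n) :=
  descend (orbitClass n) ((restrictFormMap n).comp (levelToForms n))
    (Quotient.lift ((restrictFormMap n).comp (levelToForms n)) (by
      rintro _ w ⟨t, rfl⟩
      exact congrArg (restrictForm n) (levelToForms_smul t w)))
    (fun _ => rfl)

/-- The `p_i (1 + B)` are points of the orbit of rank one projectors. -/
theorem isRankOneProjector_mul {p : MatTuple n} (hp : p ∈ orthogonalSystems n) (i : Fin n)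
    (B : Matrix (Fin n) (Fin n) ℂ) (hB : p i * B * p i = 0) :
    IsRankOneProjector (p i * (1 + B)) := by
  obtain ⟨g, hg, hpg⟩ := exists_frame hp
  have hu := isUnit_iff_ne_zero.mpr hg
  have e : p i * (1 + B) = g * q i * (g⁻¹ * (1 + B)) := by
    rw [← hpg, ← mul_assoc, Matrix.mul_nonsing_inv_cancel_right _ _ hu]
  rw [e]
  refine isRankOneProjector_of i _ _ ?_
  have h1 : q i = g⁻¹ * (p i * g) := by rw [hpg, Matrix.nonsing_inv_mul_cancel_left _ _ hu]
  have h2 : q i * g⁻¹ = g⁻¹ * p i := by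
    rw [h1, mul_assoc, Matrix.mul_nonsing_inv_cancel_right _ _ hu]
  calc q i * (g⁻¹ * (1 + B) * g) * q i
      = (q i * g⁻¹) * (1 + B) * (g * q i) := by simp only [mul_assoc]
    _ = g⁻¹ * (p i * p i + p i * B * p i) * g := by rw [h2, ← hpg]; noncomm_ring
    _ = q i := by rw [(hp.1 i).1, hB, add_zero, h1, mul_assoc]

/-- The matrix-valued function `1 + B`. -/
def ambientForms.R : (ambientForms n).MatrixFunction n :=
  (MatrixFunction.const _ 1).add ambientForms.B

/-- The map `φ` in terms of ambient covectors: the morphism `(p, C) ↦ (p_i (1 + B))_i`. -/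
def formsToY (n : ℕ) : RegularMap (ambientForms n) (Y n) :=
  RegularMap.mkAffine (S := projectorTuples n)
    (fun y => ⟨fun i => y.1.1 i * (1 + ambientForms.B.1 y), fun i =>
      isRankOneProjector_mul y.2.1 i _ (ambientForms.p_mul_B_mul_p i y)⟩)
    fun l x => regAt_functional (fun i => (ambientForms.p i).mul ambientForms.R) l x

theorem formsToY_eq_of_restrictForm_eq {y y' : ambientForms n}
    (h : restrictForm n y = restrictForm n y') : formsToY n y = formsToY n y' := by
  obtain ⟨hp, hB⟩ := (restrictForm_eq_iff y y').mp h
  refine Subtype.ext (funext fun i => ?_)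
  change y.1.1 i * (1 + ambientForms.B.1 y) = y'.1.1 i * (1 + ambientForms.B.1 y')
  rw [hp, hB]

theorem formsToY_levelToForms (z : Z n) : formsToY n (levelToForms n z) = phiLevel n z := by
  refine Subtype.ext (funext fun i => ?_)
  change pOf i z * (1 + ambientForms.B.1 (levelToForms n z)) = rOf i z
  rw [B_levelToForms]
  rfl

/-- Every covector of `X` comes from `μ_T⁻¹(0)`: take a frame `g` of `p`, and `A = g⁻¹ B`. -/
theorem exists_restrictForm_levelToForms (y : ambientForms n) :
    ∃ z : Z n, restrictForm n (levelToForms n z) = restrictForm n y := by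
  obtain ⟨g, hg, hpg⟩ := exists_frame y.2.1
  have hu := isUnit_iff_ne_zero.mpr hg
  let B := ambientForms.B.1 y
  have hd : (g⁻¹ * B * g).diag = 0 := by
    funext i
    have h : q i * (g⁻¹ * B * g) * q i = 0 := by
      have h1 : q i = g⁻¹ * (y.1.1 i * g) := by
        rw [hpg, Matrix.nonsing_inv_mul_cancel_left _ _ hu]
      have h2 : q i * g⁻¹ = g⁻¹ * y.1.1 i := by
        rw [h1, mul_assoc, Matrix.mul_nonsing_inv_cancel_right _ _ hu]
      calc q i * (g⁻¹ * B * g) * q i = (q i * g⁻¹) * B * (g * q i) := by simp only [mul_assoc]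
        _ = g⁻¹ * (y.1.1 i * B * y.1.1 i) * g := by rw [h2, ← hpg]; simp only [mul_assoc]
        _ = 0 := by
          rw [show y.1.1 i * B * y.1.1 i = 0 from ambientForms.p_mul_B_mul_p i y, mul_zero,
            zero_mul]
    have := congrFun (congrFun h i) i
    rwa [mul_q_apply, q_mul_apply, if_pos rfl, if_pos rfl] at this
  let z : Z n := ⟨(g, g⁻¹ * B), hg, hd⟩
  refine ⟨z, (restrictForm_eq_iff _ _).mpr ⟨funext fun i => (eq_pOf (z := z) (hpg i)).symm, ?_⟩⟩
  rw [B_levelToForms]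
  exact Matrix.mul_nonsing_inv_cancel_left _ _ hu

theorem exists_phi_eq_formsToY (y : ambientForms n) : ∃ x, phi n x = formsToY n y := by
  obtain ⟨z, hz⟩ := exists_restrictForm_levelToForms y
  refine ⟨reductionMap n z, ?_⟩
  rw [← formsToY_eq_of_restrictForm_eq hz, formsToY_levelToForms]
  rfl

/-- The lift of `formsToY` along the open embedding `phi`. -/
noncomputable def formsToReduction (n : ℕ) : RegularMap (ambientForms n) (reduction n) :=
  isOpenEmbedding_phi.lift (formsToY n) exists_phi_eq_formsToY

theorem phi_formsToReduction (y : ambientForms n) : phi n (formsToReduction n y) = formsToY n y :=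
  isOpenEmbedding_phi.apply_lift _ _ y

theorem formsToReduction_eq_of_restrictForm_eq {y y' : ambientForms n}
    (h : restrictForm n y = restrictForm n y') : formsToReduction n y = formsToReduction n y' := by
  apply phi_injective
  rw [phi_formsToReduction, phi_formsToReduction, formsToY_eq_of_restrictForm_eq h]

/-- The morphism `Ω¹X → μ_T⁻¹(0)/T`. -/
noncomputable def cotangentToReduction (n : ℕ) : RegularMap (cotangentBundle n) (reduction n) :=
  descend (restrictForm n) (formsToReduction n)
    (fun ξ => formsToReduction n (Function.surjInv restrictForm_surjective ξ))
    (fun y => formsToReduction_eq_of_restrictForm_eq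
      (Function.surjInv_eq restrictForm_surjective (restrictForm n y)))

theorem cotangentToReduction_restrictForm (y : ambientForms n) :
    cotangentToReduction n (restrictFormMap n y) = formsToReduction n y :=
  formsToReduction_eq_of_restrictForm_eq
    (Function.surjInv_eq restrictForm_surjective (restrictForm n y))

theorem cotangentToReduction_reductionToCotangent (x : reduction n) :
    cotangentToReduction n (reductionToCotangent n x) = x := by
  induction x using Quotient.inductionOn with | h z => ?_
  apply phi_injective
  refine (congrArg (phi n) (cotangentToReduction_restrictForm (levelToForms n z))).trans ?_
  rw [phi_formsToReduction, formsToY_levelToForms]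
  rfl

theorem reductionToCotangent_cotangentToReduction (ξ : cotangentBundle n) :
    reductionToCotangent n (cotangentToReduction n ξ) = ξ := by
  obtain ⟨y, rfl⟩ := restrictForm_surjective ξ
  obtain ⟨z, hz⟩ := exists_restrictForm_levelToForms y
  rw [← hz]
  exact congrArg (reductionToCotangent n) (cotangentToReduction_reductionToCotangent
    (reductionMap n z))

/-- The isomorphism `μ_T⁻¹(0)/T ≅ Ω¹X`. -/
noncomputable def reductionEquivCotangent (n : ℕ) :
    RegularEquiv (reduction n) (cotangentBundle n) where
  toMap := reductionToCotangent n
  invMap := cotangentToReduction n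
  left_inv := cotangentToReduction_reductionToCotangent
  right_inv := reductionToCotangent_cotangentToReduction

theorem isCotangentIdentification_reductionEquivCotangent :
    IsCotangentIdentification (reductionEquivCotangent n) := by
  intro z
  refine ⟨(restrictForm n (levelToForms n z)).2, rfl, fun u => ?_⟩
  have h := restrictForm_apply (levelToForms n z) ((baseMap n).tangentMap z u)
    ((Z.g).d z u * (z.1.1)⁻¹) fun i =>
      d_eq_of_frame (i := i) (x := z) (Z.p i) Z.g z.2.1 (fun w => pOf_mul_g i w) u
  refine h.trans ?_
  rw [B_levelToForms, ← mul_assoc,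
    Matrix.nonsing_inv_mul_cancel_right _ _ (isUnit_iff_ne_zero.mpr z.2.1),
    Matrix.trace_mul_comm]
  rfl

/-! ### The symplectic forms -/

/-- On `μ_T⁻¹(0)`, the pull-back of `ω_Y` is `Tr (dA ∧ dg)`. -/
theorem pullback_phiLevel_omegaY :
    TwoTensor.pullback (phiLevel n) (omegaY n) = traceWedge Z.A Z.g := by
  funext z
  refine LinearMap.ext₂ fun u v => ?_
  let R : (Z n).MatrixFunction n := (MatrixFunction.const _ 1).add (Z.g.mul Z.A)
  have hR : ∀ i (y : Z n), (Z.p i).1 y * R.1 y * (Z.p i).1 y = (Z.p i).1 y := by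
    intro i y
    change pOf i y * (1 + y.1.1 * y.1.2) * pOf i y = pOf i y
    rw [mul_add, mul_one, add_mul, pOf_mul_pOf, pOf_mul_mul_pOf, add_zero]
  have hd : ∀ w : (Z n).tangentSpace z, R.d z w = (Z.g).d z w * z.1.2 + z.1.1 * (Z.A).d z w := by
    intro w
    rw [MatrixFunction.d_add, MatrixFunction.d_const, MatrixFunction.d_mul, zero_add]
    rfl
  have hgen : ∀ (w : (Z n).tangentSpace z) (i : Fin n), (Z.p i).d z w =
      (Z.g).d z w * (z.1.1)⁻¹ * (Z.p i).1 z - (Z.p i).1 z * ((Z.g).d z w * (z.1.1)⁻¹) :=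
    fun w i => d_eq_of_frame (i := i) (x := z) (Z.p i) Z.g z.2.1 (fun w => pOf_mul_g i w) w
  refine (sum_trace_projector_form (fun i => Z.p i) R (fun y => pOf_mem y) hR (hgen u)
    (hgen v)).trans ?_
  change _ = ((Z.A).d z u * (Z.g).d z v).trace - ((Z.A).d z v * (Z.g).d z u).trace
  rw [hd, hd]
  change _ - _ - ((1 + z.1.1 * z.1.2) * _).trace = _
  have hinv : z.1.1⁻¹ * z.1.1 = 1 := inv_mul_Z z
  generalize (Z.g).d z u = a
  generalize (Z.g).d z v = b
  generalize (Z.A).d z u = c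
  generalize (Z.A).d z v = d
  generalize z.1.1⁻¹ = k at *
  generalize z.1.1 = g at *
  generalize z.1.2 = A
  have e1 : ∀ a b c : Matrix (Fin n) (Fin n) ℂ, ((a * A + g * c) * (b * k)).trace =
      (g * A * (b * k * (a * k))).trace + (c * b).trace := by
    intro a b c
    have h1 : (a * A * (b * k)).trace = (g * A * (b * k * (a * k))).trace := by
      calc (a * A * (b * k)).trace = (k * g * (A * (b * k * a))).trace := by
            rw [hinv, one_mul, mul_assoc, Matrix.trace_mul_comm]
            simp only [mul_assoc]
        _ = _ := by
            rw [mul_assoc k, Matrix.trace_mul_comm]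
            simp only [mul_assoc]
    have h2 : (g * c * (b * k)).trace = (c * b).trace := by
      rw [← mul_assoc, Matrix.trace_mul_comm, mul_assoc g, ← mul_assoc k, hinv, one_mul]
    rw [add_mul, Matrix.trace_add, h1, h2]
  have e2 : (b * k * (a * k)).trace = (a * k * (b * k)).trace := Matrix.trace_mul_comm _ _
  rw [e1, e1, add_mul, one_mul, Matrix.trace_add, Matrix.trace_sub, e2, mul_sub, Matrix.trace_sub]
  ring

/-- On `T^*𝔸|_X`, the pull-back of `ω_Y` is `∑ Tr (dC_i ∧ dp_i)`. -/
theorem pullback_formsToY_omegaY (y : ambientForms n) :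
    TwoTensor.pullback (formsToY n) (omegaY n) y =
      ∑ i, traceWedge (ambientForms.C i) (ambientForms.p i) y := by
  refine LinearMap.ext₂ fun u v => ?_
  have hR : ∀ i (y : ambientForms n), (ambientForms.p i).1 y * ambientForms.R.1 y *
      (ambientForms.p i).1 y = (ambientForms.p i).1 y := by
    intro i y
    change (ambientForms.p i).1 y * (1 + ambientForms.B.1 y) * (ambientForms.p i).1 y = _
    rw [mul_add, mul_one, add_mul, ambientForms.p_mul_B_mul_p, add_zero,
      ((ambientForms.p_mem y).1 i).1]
  obtain ⟨γ, hγ⟩ := exists_generator (fun i => ambientForms.p i) ambientForms.p_mem u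
  obtain ⟨δ, hδ⟩ := exists_generator (fun i => ambientForms.p i) ambientForms.p_mem v
  refine (sum_trace_projector_form (fun i => ambientForms.p i) ambientForms.R
    ambientForms.p_mem hR hγ hδ).trans ?_
  have hsum : (∑ i, traceWedge (ambientForms.C i) (ambientForms.p i) y) u v =
      ∑ i, (((ambientForms.C i).d y u * (ambientForms.p i).d y v).trace -
        ((ambientForms.C i).d y v * (ambientForms.p i).d y u).trace) := by
    rw [LinearMap.sum_apply, LinearMap.sum_apply]
    rfl
  have hd : ∀ w : (ambientForms n).tangentSpace y, ambientForms.R.d y w =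
      ∑ i, ((ambientForms.p i).d y w * (ambientForms.C i).1 y -
          (ambientForms.C i).1 y * (ambientForms.p i).d y w +
        ((ambientForms.p i).1 y * (ambientForms.C i).d y w -
          (ambientForms.C i).d y w * (ambientForms.p i).1 y)) := by
    intro w
    rw [ambientForms.R, MatrixFunction.d_add, MatrixFunction.d_const, zero_add, ambientForms.B,
      MatrixFunction.d_sum]
    exact Finset.sum_congr rfl fun i _ => MatrixFunction.d_commutator _ _ _
  have hR1 : (ambientForms.R.1 y * (δ * γ - γ * δ)).trace =
      ∑ i, (((ambientForms.p i).1 y * (ambientForms.C i).1 y -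
        (ambientForms.C i).1 y * (ambientForms.p i).1 y) * (δ * γ - γ * δ)).trace := by
    change ((1 + ambientForms.B.1 y) * (δ * γ - γ * δ)).trace = _
    rw [add_mul, one_mul, Matrix.trace_add, Matrix.trace_sub, Matrix.trace_mul_comm, sub_self,
      zero_add, ambientForms.B_val, Finset.sum_mul, Matrix.trace_sum]
    rfl
  rw [hsum, hd, hd, hR1, Finset.sum_mul, Finset.sum_mul, Matrix.trace_sum, Matrix.trace_sum,
    ← Finset.sum_sub_distrib, ← Finset.sum_sub_distrib]
  refine Finset.sum_congr rfl fun i _ => ?_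
  have hγi : (ambientForms.p i).d y u = _ := hγ i
  have hδi : (ambientForms.p i).d y v = _ := hδ i
  have hc : ∀ p c δ : Matrix (Fin n) (Fin n) ℂ,
      ((p * c - c * p) * δ).trace = (c * (δ * p - p * δ)).trace := fun p c δ => by
    rw [Matrix.trace_mul_comm, trace_mul_commutator, trace_mul_commutator]
  rw [hγi, hδi, add_mul, add_mul, Matrix.trace_add, Matrix.trace_add, ← trace_jacobi,
    hc _ ((ambientForms.C i).d y u), hc _ ((ambientForms.C i).d y v)]
  ring

theorem phi_comp_invMap_comp_reductionMap :
    ((phi n).comp (reductionEquivCotangent n).invMap).comp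
      ((reductionEquivCotangent n).toMap.comp (reductionMap n)) = phiLevel n :=
  RegularMap.ext fun z => congrArg (phi n)
    (cotangentToReduction_reductionToCotangent (reductionMap n z))

theorem phi_comp_invMap_comp_restrictFormMap :
    ((phi n).comp (reductionEquivCotangent n).invMap).comp (restrictFormMap n) = formsToY n :=
  RegularMap.ext fun y => (congrArg (phi n) (cotangentToReduction_restrictForm y)).trans
    (phi_formsToReduction y)

theorem isReducedForm_pullback_omegaY : IsReducedForm (reductionEquivCotangent n)
    (TwoTensor.pullback ((phi n).comp (reductionEquivCotangent n).invMap) (omegaY n)) := by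
  rw [IsReducedForm, ← TwoTensor.pullback_comp, phi_comp_invMap_comp_reductionMap,
    pullback_phiLevel_omegaY]

theorem isCanonicalForm_pullback_omegaY : IsCanonicalForm
    (TwoTensor.pullback ((phi n).comp (reductionEquivCotangent n).invMap) (omegaY n)) := by
  intro y
  rw [← TwoTensor.pullback_comp, phi_comp_invMap_comp_restrictFormMap, pullback_formsToY_omegaY]

/-- The morphism `μ_T⁻¹(0) → Ω¹X` is a submersion: it has local sections, obtained from those of
`μ_T⁻¹(0) → Y` by composition with `φ`. -/
theorem tangentMap_reductionMap_surjective (z : Z n) : Function.Surjective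
    (((reductionEquivCotangent n).toMap.comp (reductionMap n)).tangentMap z) := by
  obtain ⟨h, W, hW, hzW, hsec⟩ := isLocalSectionAt_levelSection z
  let e := reductionEquivCotangent n
  let ψ := (phi n).comp e.invMap
  have hψ : ψ (e.toMap (reductionMap n z)) = phiLevel n z :=
    congrArg (phi n) (e.left_inv (reductionMap n z))
  have h' : IsLocalSectionAt (e.toMap.comp (reductionMap n)) (fun ξ => levelSection z (ψ ξ))
      (e.toMap (reductionMap n z)) := by
    refine ⟨IsRegularMapAt.comp (s := levelSection z) (t := ψ) (by rwa [hψ])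
      (ψ.isRegularMapAt _), ψ ⁻¹' W, ψ.isOpen_preimage W hW, ?_, fun ξ hξ => ?_⟩
    · change ψ _ ∈ W
      rwa [hψ]
    · have h1 : reductionMap n (levelSection z (ψ ξ)) = e.invMap ξ :=
        phi_injective (hsec (ψ ξ) hξ)
      exact (congrArg e.toMap h1).trans (e.right_inv ξ)
  refine IsLocalSectionAt.tangentMap_surjective h' ?_
  exact (congrArg (levelSection z) hψ).trans (levelSection_phiLevel z)

theorem tangentMap_restrictFormMap_surjective (z : Z n) : Function.Surjective
    ((restrictFormMap n).tangentMap (levelToForms n z)) := by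
  intro D
  obtain ⟨u, hu⟩ := tangentMap_reductionMap_surjective z D
  exact ⟨(levelToForms n).tangentMap z u, hu⟩

theorem exists_levelToForms (ξ : cotangentBundle n) :
    ∃ z : Z n, restrictFormMap n (levelToForms n z) = ξ := by
  obtain ⟨y, rfl⟩ := restrictForm_surjective ξ
  exact exists_restrictForm_levelToForms y

theorem IsReducedForm.unique {ω ω' : TwoTensor (cotangentBundle n)}
    (h : IsReducedForm (reductionEquivCotangent n) ω)
    (h' : IsReducedForm (reductionEquivCotangent n) ω') : ω = ω' := by
  funext ξ
  obtain ⟨z, rfl⟩ := exists_levelToForms ξ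
  change ω ((reductionEquivCotangent n).toMap.comp (reductionMap n) z) =
    ω' ((reductionEquivCotangent n).toMap.comp (reductionMap n) z)
  exact TwoTensor.eq_of_pullback_eq (tangentMap_reductionMap_surjective z)
    (congrFun (h.trans h'.symm) z)

theorem IsCanonicalForm.unique {ω ω' : TwoTensor (cotangentBundle n)}
    (h : IsCanonicalForm ω) (h' : IsCanonicalForm ω') : ω = ω' := by
  funext ξ
  obtain ⟨z, rfl⟩ := exists_levelToForms ξ
  exact TwoTensor.eq_of_pullback_eq (tangentMap_restrictFormMap_surjective z)
    ((h _).trans (h' _).symm)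

end Projectors

theorem mainTheorem1 (n : ℕ) :
    ∃ ι : SpaceWithFunctions.RegularEquiv (Projectors.reduction n) (Projectors.cotangentBundle n),
      Projectors.IsCotangentIdentification ι ∧
      ((Projectors.phi n).comp ι.invMap).IsOpenEmbedding ∧
      (∀ ω : SpaceWithFunctions.TwoTensor (Projectors.cotangentBundle n),
        Projectors.IsReducedForm ι ω ↔
          ω = SpaceWithFunctions.TwoTensor.pullback ((Projectors.phi n).comp ι.invMap)
            (Projectors.omegaY n)) ∧
      (∀ ω : SpaceWithFunctions.TwoTensor (Projectors.cotangentBundle n),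
        Projectors.IsCanonicalForm ω ↔
          ω = SpaceWithFunctions.TwoTensor.pullback ((Projectors.phi n).comp ι.invMap)
            (Projectors.omegaY n)) :=
  ⟨Projectors.reductionEquivCotangent n,
    Projectors.isCotangentIdentification_reductionEquivCotangent,
    Projectors.isOpenEmbedding_phi.comp_invMap (Projectors.reductionEquivCotangent n),
    fun _ => ⟨fun h => h.unique Projectors.isReducedForm_pullback_omegaY,
      fun h => h ▸ Projectors.isReducedForm_pullback_omegaY⟩,
    fun _ => ⟨fun h => h.unique Projectors.isCanonicalForm_pullback_omegaY,
      fun h => h ▸ Projectors.isCanonicalForm_pullback_omegaY⟩⟩
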